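/- **Conventions.** A function $f:(0,\infty)\to(0,\infty)$ is *standard monotone* if it is matrix monotone, $f(x)=x f(x^{-1})$ for all $x>0$, and $f(1)=1$. For a positive definite matrix $\pi$ let $\mathbb L_\pi[A]=\pi A$, $\mathbb R_\pi[A]=A\pi$, and $$\mathbb J_f|_\pi:=\mathbb R_\pi\, f(\mathbb L_\pi\mathbb R_\pi^{-1}),\qquad \mathbb J_f^{-1}|_\pi=\mathbb R_\pi^{-1}\,\tfrac1f(\mathbb L_\pi\mathbb R_\pi^{-1}).$$ For states $\rho,\sigma$ with $\rho$ of full rank put $\chi^2_f(\rho\|\sigma):=\operatorname{Tr}\big[(\rho-\sigma)\,\mathbb J_f^{-1}|_\rho[\rho-\sigma]\big]$. For a completely positive trace-preserving map $\Phi$ with Hilbert–Schmidt adjoint $\Phi^\dagger$, the *generalised Petz map* is $\widetilde\Phi_{(f',f),\rho}:=\mathbb J_{f'}|_\rho\circ\Phi^\dagger\circ\mathbb J_f^{-1}|_{\Phi(\rho)}$. It *recovers both states* if $$\widetilde\Phi_{(f',f),\rho}\,\Phi(\rho)=\rho\quad\text{and}\quad\widetilde\Phi_{(f',f),\rho}\,\Phi(\sigma)=\sigma.\qquad(*)$$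 **Statement.** Let $\Phi$ be a completely positive trace-preserving map between complex matrix algebras, and let $\rho,\sigma$ be density matrices with $\rho$ and $\Phi(\rho)$ of full rank. Suppose $\chi^2_f(\rho\|\sigma)=\chi^2_f(\Phi(\rho)\|\Phi(\sigma))$ for some standard monotone function $f$. Then: 1. for every standard monotone $f'$ that differs from $f$ in the sense that $f'(a/b)\neq f(a/b)$ for all distinct eigenvalues $a\ne b$ of $\rho$ (in particular whenever $f'(x)\ne f(x)$ for all $x\neq1$), $(*)$ holds if and only if $[\rho,\sigma]=0$; 2. $(*)$ holds for all standard monotone functions $f'\not\equiv f$ if and only if $[\rho,\sigma]=0$; 3. if $[\rho,\sigma]=0$ and $\mathbb J_f^{-1}|_{\Phi(\rho)}$ is completely positive (in particular, if $\mathbb J_f^{-1}|_\pi$ is completely positive for every full-rank $\pi$), then $\chi^2_{g}(\rho\|\sigma)=\chi^2_{g}(\Phi(\rho)\|\Phi(\sigma))$ for every standard monotone function $g$. -/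

import Mathlib

open scoped Kronecker ComplexOrder

namespace QuantumFisher

noncomputable section

/-- `f` is a standard monotone function: a positive matrix monotone function on `(0, ∞)` with
`f x = x * f (x⁻¹)` and `f 1 = 1`. Only the values of `f` on `(0, ∞)` matter. -/
structure IsStandardMonotone (f : ℝ → ℝ) : Prop where
  pos : ∀ x : ℝ, 0 < x → 0 < f x
  monotone : ∀ (k : ℕ) (A B : Matrix (Fin k) (Fin k) ℂ), A.PosDef → B.PosDef →
    (B - A).PosSemidef → (cfc f B - cfc f A).PosSemidef
  symm : ∀ x : ℝ, 0 < x → f x = x * f x⁻¹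
  one : f 1 = 1

/-- A density matrix (state): positive semidefinite with unit trace. -/
def IsState {n : Type*} [Fintype n] (ρ : Matrix n n ℂ) : Prop :=
  ρ.PosSemidef ∧ ρ.trace = 1

/-- Complete positivity of a linear map between matrix algebras: for every `k`, the map
`id_k ⊗ Φ`, which applies `Φ` to every block of a `k × k` block matrix, preserves positive
semidefiniteness. -/
def IsCompletelyPositive {n m : Type*} [Fintype n] [Fintype m]
    (Φ : Matrix n n ℂ →ₗ[ℂ] Matrix m m ℂ) : Prop :=
  ∀ (k : ℕ) (X : Matrix (Fin k × n) (Fin k × n) ℂ), X.PosSemidef →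
    (Matrix.of fun p q : Fin k × m =>
      Φ (Matrix.of fun a b : n => X (p.1, a) (q.1, b)) p.2 q.2).PosSemidef

/-- A quantum channel: a completely positive trace-preserving linear map. -/
def IsCPTP {n m : Type*} [Fintype n] [Fintype m]
    (Φ : Matrix n n ℂ →ₗ[ℂ] Matrix m m ℂ) : Prop :=
  IsCompletelyPositive Φ ∧ ∀ A : Matrix n n ℂ, (Φ A).trace = A.trace

variable {n m : Type*} [Fintype n] [DecidableEq n] [Fintype m] [DecidableEq m]

/-- The superoperator on `n × n` matrices whose matrix in the basis of matrix units (the unit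
`E_{ij}` being indexed by the pair `(i, j)`) is `M`. -/
def superop (M : Matrix (n × n) (n × n) ℂ) : Matrix n n ℂ →ₗ[ℂ] Matrix n n ℂ where
  toFun A := Matrix.of fun i j => ∑ p : n × n, M (i, j) p * A p.1 p.2
  map_add' A B := by
    ext i j
    simp [mul_add, Finset.sum_add_distrib]
  map_smul' c A := by
    ext i j
    simp [Finset.mul_sum, mul_left_comm]

/-- The matrix, in the orthonormal basis of matrix units, of the modular operator
`L_π R_π⁻¹ : A ↦ π A π⁻¹`. -/
def modular (π : Matrix n n ℂ) : Matrix (n × n) (n × n) ℂ :=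
  π ⊗ₖ (π⁻¹).transpose

theorem superop_modular (π A : Matrix n n ℂ) : superop (modular π) A = π * A * π⁻¹ := by
  ext i j
  simp only [superop, modular, LinearMap.coe_mk, AddHom.coe_mk, Matrix.of_apply,
    Matrix.kroneckerMap_apply, Matrix.transpose_apply, Fintype.sum_prod_type, Matrix.mul_apply,
    Finset.sum_mul]
  rw [Finset.sum_comm]
  exact Finset.sum_congr rfl fun b _ => Finset.sum_congr rfl fun a _ => by ring

/-- The quantum Fisher operator `J_f|_π = R_π f(L_π R_π⁻¹)`. -/
def J (f : ℝ → ℝ) (π : Matrix n n ℂ) : Matrix n n ℂ →ₗ[ℂ] Matrix n n ℂ :=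
  LinearMap.mulRight ℂ π ∘ₗ superop (cfc f (modular π))

/-- The inverse quantum Fisher operator `J_f⁻¹|_π = R_π⁻¹ (1/f)(L_π R_π⁻¹)`. -/
def Jinv (f : ℝ → ℝ) (π : Matrix n n ℂ) : Matrix n n ℂ →ₗ[ℂ] Matrix n n ℂ :=
  LinearMap.mulRight ℂ π⁻¹ ∘ₗ superop (cfc (fun x => 1 / f x) (modular π))

/-- The divergence `χ²_f(ρ‖σ) = Tr[(ρ - σ) J_f⁻¹|_ρ[ρ - σ]]` (this trace is real when `ρ` is a
full-rank state and `σ` is a state). -/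
def chiSq (f : ℝ → ℝ) (ρ σ : Matrix n n ℂ) : ℝ :=
  ((ρ - σ) * Jinv f ρ (ρ - σ)).trace.re

/-- The adjoint of `Φ` for the Hilbert–Schmidt inner products `⟨A, B⟩ = Tr[Aᴴ B]`. -/
def hsAdjoint (Φ : Matrix n n ℂ →ₗ[ℂ] Matrix m m ℂ) : Matrix m m ℂ →ₗ[ℂ] Matrix n n ℂ where
  toFun B := Matrix.of fun i j => ((Φ (Matrix.single i j 1)).conjTranspose * B).trace
  map_add' A B := by
    ext i j
    simp [Matrix.mul_add]
  map_smul' c A := by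
    ext i j
    simp

theorem trace_hsAdjoint (Φ : Matrix n n ℂ →ₗ[ℂ] Matrix m m ℂ) (A : Matrix n n ℂ)
    (B : Matrix m m ℂ) :
    (A.conjTranspose * hsAdjoint Φ B).trace = ((Φ A).conjTranspose * B).trace := by
  conv_rhs => rw [Matrix.matrix_eq_sum_single A]
  have h : ∀ i j, Matrix.single i j (A i j) = A i j • Matrix.single i j (1 : ℂ) := by
    intro i j
    simp [Matrix.smul_single]
  simp only [h, map_sum, map_smul, Matrix.conjTranspose_sum, Matrix.conjTranspose_smul,
    Matrix.sum_mul, Matrix.trace_sum, Matrix.smul_mul, Matrix.trace_smul]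
  simp only [Matrix.trace, Matrix.diag, Matrix.mul_apply (M := A.conjTranspose), hsAdjoint,
    LinearMap.coe_mk, AddHom.coe_mk, Matrix.of_apply, Matrix.conjTranspose_apply, smul_eq_mul]
  rw [Finset.sum_comm]

/-- The generalised Petz recovery map `J_{f'}|_π ∘ Φ† ∘ J_f⁻¹|_{Φ(π)}`. -/
def petz (f' f : ℝ → ℝ) (π : Matrix n n ℂ) (Φ : Matrix n n ℂ →ₗ[ℂ] Matrix m m ℂ) :
    Matrix m m ℂ →ₗ[ℂ] Matrix n n ℂ :=
  J f' π ∘ₗ hsAdjoint Φ ∘ₗ Jinv f (Φ π)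

/-- The map `petz f' f ρ Φ` recovers both `ρ` and `σ` after the action of `Φ`. -/
def RecoversBoth (f' f : ℝ → ℝ) (ρ σ : Matrix n n ℂ) (Φ : Matrix n n ℂ →ₗ[ℂ] Matrix m m ℂ) :
    Prop :=
  petz f' f ρ Φ (Φ ρ) = ρ ∧ petz f' f ρ Φ (Φ σ) = σ

end

end QuantumFisher

/-! Write Δ for the modular operator L_ρ R_ρ⁻¹. In the basis of matrix units, `J f ρ` has matrix
F_f(ρ) = R_ρ f(Δ), an operator mean of the positive definite matrices L_ρ and R_ρ. Let K be the
matrix of Φ. Complete positivity on 2 × 2 blocks gives K R_ρ K* ≤ R_{Φ(ρ)}, and the same for L.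
Hansen's inequality (`conj_cfc_le`) carries both bounds over to the mean, and inversion through
Schur complements yields K* F_f(Φ(ρ))⁻¹ K ≤ F_f(ρ)⁻¹ (`conj_inv_fisherMatrix_le`). This is the data
processing inequality. In the case of equality, the difference of the two sides is a positive
semidefinite matrix whose quadratic form vanishes at ρ - σ, so it annihilates ρ - σ. Hence Φ†
J_f⁻¹|_{Φ(ρ)} Φ(σ) = J_f⁻¹|_ρ σ (`hsAdjoint_Jinv_map_of_chiSq_eq`).

The Petz map therefore sends Φ(σ) to J_{f'} J_f⁻¹ σ. Since ρ is always recovered, recovery of both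
states means (1/f')(Δ)σ = (1/f)(Δ)σ. The spectrum of Δ consists of ratios of eigenvalues of ρ. If f
and f' differ at every such ratio other than 1, then Δσ = σ, which says that ρ and σ commute. When
all f' are allowed, the arithmetic and harmonic functions suffice, because they agree only at 1.
Conversely, if ρ and σ commute, then every J_f and J_f⁻¹ acts on the relevant matrices as
multiplication by ρ or ρ⁻¹, and recovery is immediate.

For the last claim, ρ^{1/2} Φ†(J_f⁻¹(·)) ρ^{1/2} is a channel that undoes Φ on both states
(`exists_recovery_channel`). Data processing along Φ and along this channel gives equality for every
g. -/

namespace QuantumFisher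

/-! ### Functional calculus under isometries, and the matrix order. -/

section FunctionalCalculus

set_option linter.unusedSectionVars false

open scoped MatrixOrder ComplexOrder Kronecker
open Matrix

variable {a b : Type*} [Fintype a] [DecidableEq a] [Fintype b] [DecidableEq b]

theorem continuousOn_spectrum (A : Matrix a a ℂ) (f : ℝ → ℝ) : ContinuousOn f (spectrum ℝ A) :=
  Matrix.finite_real_spectrum.continuousOn f

theorem exists_polynomial_eqOn {s : Set ℝ} (hs : s.Finite) (f : ℝ → ℝ) :
    ∃ p : Polynomial ℝ, ∀ x ∈ s, p.eval x = f x :=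
  ⟨Lagrange.interpolate hs.toFinset id f, fun _ hx =>
    Lagrange.eval_interpolate_at_node (v := id) f (Set.injOn_id _) (hs.mem_toFinset.2 hx)⟩

theorem cfc_eq_aeval {A : Matrix a a ℂ} (hA : A.IsHermitian) {f : ℝ → ℝ} {p : Polynomial ℝ}
    (h : ∀ x ∈ spectrum ℝ A, p.eval x = f x) : cfc f A = Polynomial.aeval A p := by
  have hA' : IsSelfAdjoint A := hA
  rw [← cfc_polynomial p A]
  exact cfc_congr fun x hx => (h x hx).symm

/-- The two summands are supported on the range of `W` and on its orthogonal complement. Their cross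
products vanish, so powers are taken separately on each. -/
theorem aeval_isometry_conj {W : Matrix b a ℂ} (hW : Wᴴ * W = 1) (B : Matrix a a ℂ) (l : ℝ)
    (p : Polynomial ℝ) :
    Polynomial.aeval (W * B * Wᴴ + l • (1 - W * Wᴴ)) p =
      W * Polynomial.aeval B p * Wᴴ + p.eval l • (1 - W * Wᴴ) := by
  have hW1 : Wᴴ * (1 - W * Wᴴ) = 0 := by
    rw [Matrix.mul_sub, ← Matrix.mul_assoc, hW]; simp
  have hW2 : (1 - W * Wᴴ) * (1 - W * Wᴴ) = 1 - W * Wᴴ := by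
    rw [Matrix.sub_mul, Matrix.mul_assoc W, hW1]; simp
  have hW3 : (1 - W * Wᴴ) * W = 0 := by
    rw [Matrix.sub_mul, Matrix.mul_assoc, hW]; simp
  have hpow : ∀ k : ℕ, (W * B * Wᴴ + l • (1 - W * Wᴴ)) ^ k =
      W * B ^ k * Wᴴ + l ^ k • (1 - W * Wᴴ) := by
    intro k
    induction k with
    | zero => simp
    | succ k ih =>
      rw [pow_succ, ih, Matrix.add_mul, Matrix.mul_add, Matrix.mul_add]
      have e1 : W * B ^ k * Wᴴ * (W * B * Wᴴ) = W * B ^ (k + 1) * Wᴴ := by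
        calc _ = W * B ^ k * (Wᴴ * W) * B * Wᴴ := by simp only [Matrix.mul_assoc]
          _ = _ := by rw [hW, pow_succ]; simp only [Matrix.mul_assoc, Matrix.mul_one]
      have e2 : W * B ^ k * Wᴴ * (l • (1 - W * Wᴴ)) = 0 := by
        rw [Matrix.mul_smul, Matrix.mul_assoc, hW1]; simp
      have e3 : (l ^ k • (1 - W * Wᴴ)) * (W * B * Wᴴ) = 0 := by
        rw [Matrix.smul_mul, Matrix.mul_assoc W, ← Matrix.mul_assoc (1 - _), hW3]; simp
      rw [e1, e2, e3, Matrix.smul_mul, Matrix.mul_smul, hW2, smul_smul, ← pow_succ]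
      simp
  induction p using Polynomial.induction_on' with
  | add p q hp hq =>
    simp only [map_add, hp, hq, Polynomial.eval_add, Matrix.mul_add, Matrix.add_mul, add_smul]
    abel
  | monomial k r =>
    rw [Polynomial.aeval_monomial, Polynomial.aeval_monomial, hpow, Polynomial.eval_monomial]
    simp only [← Algebra.smul_def, smul_add, smul_smul, Matrix.mul_smul, Matrix.smul_mul]

theorem isHermitian_isometry_conj (W : Matrix b a ℂ) {B : Matrix a a ℂ}
    (hB : B.IsHermitian) (l : ℝ) : (W * B * Wᴴ + l • (1 - W * Wᴴ)).IsHermitian := by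
  rw [Matrix.IsHermitian]
  simp [Matrix.conjTranspose_mul, hB.eq, Matrix.mul_assoc]

/-- A single polynomial interpolating `f` on both spectra and at `l` reduces this to the polynomial
case. -/
theorem cfc_isometry_conj {W : Matrix b a ℂ} (hW : Wᴴ * W = 1) {B : Matrix a a ℂ}
    (hB : B.IsHermitian) (l : ℝ) (f : ℝ → ℝ) :
    cfc f (W * B * Wᴴ + l • (1 - W * Wᴴ)) = W * cfc f B * Wᴴ + f l • (1 - W * Wᴴ) := by
  obtain ⟨p, hp⟩ := exists_polynomial_eqOn
    (s := spectrum ℝ B ∪ spectrum ℝ (W * B * Wᴴ + l • (1 - W * Wᴴ)) ∪ {l})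
    ((Matrix.finite_real_spectrum.union Matrix.finite_real_spectrum).union
      (Set.finite_singleton l)) f
  rw [cfc_eq_aeval (isHermitian_isometry_conj W hB l) fun x hx => hp x (by simp [hx]),
    cfc_eq_aeval hB fun x hx => hp x (by simp [hx]), aeval_isometry_conj hW, hp l (by simp)]

theorem pos_of_mem_spectrum {A : Matrix a a ℂ} (hA : A.PosDef) {x : ℝ}
    (hx : x ∈ spectrum ℝ A) : 0 < x :=
  hA.isStrictlyPositive.spectrum_pos hx

theorem exists_pos_smul_one_le {A : Matrix a a ℂ} (hA : A.PosDef) :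
    ∃ r : ℝ, 0 < r ∧ r • (1 : Matrix a a ℂ) ≤ A := by
  have hsa : IsSelfAdjoint A := hA.1
  have hpos := hA.isStrictlyPositive
  have h : ∀ᶠ r in nhdsWithin (0 : ℝ) (Set.Ioi 0), ∀ x ∈ spectrum ℝ A, r ≤ x :=
    (Filter.eventually_all_finite Matrix.finite_real_spectrum).2 fun x hx =>
      (eventually_le_nhds (hpos.spectrum_pos hx)).filter_mono nhdsWithin_le_nhds
  obtain ⟨r, hr, hr0⟩ := (h.and self_mem_nhdsWithin).exists
  exact ⟨r, hr0, by
    simpa [Algebra.algebraMap_eq_smul_one] using algebraMap_le_of_le_spectrum hr⟩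

theorem exists_le_smul_one {A : Matrix a a ℂ} (hA : A.IsHermitian) :
    ∃ r : ℝ, 0 < r ∧ A ≤ r • (1 : Matrix a a ℂ) := by
  have hsa : IsSelfAdjoint A := hA
  obtain ⟨r, hr⟩ := (Matrix.finite_real_spectrum (A := A)).bddAbove
  exact ⟨max r 1, by positivity, by
    simpa [Algebra.algebraMap_eq_smul_one] using
      le_algebraMap_of_spectrum_le (a := A) fun x hx => (hr hx).trans (le_max_left r 1)⟩

theorem conjTranspose_mul_mul_mono {A B : Matrix a a ℂ} (h : A ≤ B) (V : Matrix a b ℂ) :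
    Vᴴ * A * V ≤ Vᴴ * B * V := by
  rw [Matrix.le_iff] at *
  simpa [Matrix.mul_sub, Matrix.sub_mul] using h.conjTranspose_mul_mul_same V

theorem mul_mul_conjTranspose_mono {A B : Matrix a a ℂ} (h : A ≤ B) (V : Matrix b a ℂ) :
    V * A * Vᴴ ≤ V * B * Vᴴ := by
  simpa using conjTranspose_mul_mul_mono h Vᴴ

theorem posDef_of_smul_one_le {A : Matrix a a ℂ} {r : ℝ} (hr : 0 < r)
    (h : r • (1 : Matrix a a ℂ) ≤ A) : A.PosDef := by
  have h1 : (r • (1 : Matrix a a ℂ)).PosDef := Matrix.PosDef.one.smul hr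
  simpa using h1.add_posSemidef (Matrix.le_iff.1 h)

/-- A positive semidefinite matrix is dominated by a multiple of its pinching. -/
theorem le_pinching {A : Matrix b b ℂ} (hA : A.PosSemidef) {c : ℝ} (hc : 1 < c)
    (W : Matrix b a ℂ) (hW : Wᴴ * W = 1) :
    ∃ l : ℝ, 0 < l ∧ A ≤ W * (c • (Wᴴ * A * W)) * Wᴴ + l • (1 - W * Wᴴ) := by
  obtain ⟨r, hr, hAr⟩ := exists_le_smul_one hA.1
  set t : ℝ := c - 1 with ht
  have ht0 : 0 < t := by linarith
  set P := W * Wᴴ with hP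
  have hPh : Pᴴ = P := by simp [hP]
  have hPP : P * P = P := by
    rw [hP, Matrix.mul_assoc, ← Matrix.mul_assoc Wᴴ, hW, Matrix.one_mul]
  have hQh : (1 - P)ᴴ = 1 - P := by simp [hPh]
  have hQQ : (1 - P) * (1 - P) = 1 - P := by
    rw [Matrix.sub_mul, Matrix.mul_sub, Matrix.mul_sub, hPP]; simp
  -- `1 + t⁻¹` is the price of absorbing the off-diagonal blocks, and `r` bounds the complementary
  -- corner of `A`.
  refine ⟨(1 + t⁻¹) * r, by positivity, ?_⟩
  have h1 : A ≤ c • (P * A * P) + (1 + t⁻¹) • ((1 - P) * A * (1 - P)) := by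
    -- With Q = 1 - P, expanding t⁻¹ (tP - Q) A (tP - Q) ≥ 0 bounds the cross terms PAQ + QAP by t
    -- PAP + t⁻¹ QAQ.
    have h2 := (hA.mul_mul_conjTranspose_same (t • P - (1 - P))).smul (inv_nonneg.2 ht0.le)
    have e : (t • P - (1 - P))ᴴ = t • P - (1 - P) := by simp [hPh]
    rw [e] at h2
    have hc' : c = 1 + t := by rw [ht]; ring
    rw [hc', Matrix.le_iff]
    set Q := 1 - P with hQ
    have hA' : P * A * P + P * A * Q + Q * A * P + Q * A * Q = A := by
      rw [hQ]; noncomm_ring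
    have e2 : (t • P - Q) * A * (t • P - Q) =
        (t * t) • (P * A * P) - t • (P * A * Q) - t • (Q * A * P) + Q * A * Q := by
      simp only [Matrix.sub_mul, Matrix.mul_sub, Matrix.smul_mul, Matrix.mul_smul, smul_smul,
        smul_sub]
      abel
    have hexp : ∀ X Y Z U : Matrix b b ℂ,
        t⁻¹ • ((t * t) • X - t • Y - t • Z + U) =
          (1 + t) • X + (1 + t⁻¹) • U - (X + Y + Z + U) := by
      intro X Y Z U
      simp only [smul_add, smul_sub, smul_smul]
      rw [← mul_assoc, inv_mul_cancel₀ ht0.ne', one_mul, one_smul, one_smul, add_smul, add_smul,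
        one_smul, one_smul]
      abel
    rw [e2, hexp, hA'] at h2
    exact h2
  refine h1.trans (add_le_add (le_of_eq ?_) ?_)
  · rw [hP]; simp only [Matrix.mul_smul, Matrix.smul_mul, Matrix.mul_assoc]
  · have h3 : (1 - P) * A * (1 - P) ≤ r • (1 - P) := by
      have := mul_mul_conjTranspose_mono hAr (1 - P)
      rw [hQh] at this
      simpa [Matrix.mul_smul, Matrix.smul_mul, hQQ] using this
    rw [mul_smul]
    exact smul_le_smul_of_nonneg_left h3 (by positivity)

end FunctionalCalculus

/-! ### Hansen's inequality for standard monotone functions. -/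

section Jensen

set_option linter.unusedSectionVars false

open scoped MatrixOrder ComplexOrder Kronecker
open Matrix

variable {a b : Type*} [Fintype a] [DecidableEq a] [Fintype b] [DecidableEq b]

theorem smul_one_le_isometry_conj (W : Matrix b a ℂ) {A : Matrix a a ℂ}
    {r : ℝ} (h : r • (1 : Matrix a a ℂ) ≤ A) :
    r • (1 : Matrix b b ℂ) ≤ W * A * Wᴴ + r • (1 - W * Wᴴ) := by
  have := add_le_add_left (mul_mul_conjTranspose_mono h W) (r • (1 - W * Wᴴ))
  simpa [smul_sub] using this

namespace IsStandardMonotone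

variable {f : ℝ → ℝ}

/-- Monotonicity is assumed only for index types `Fin k`; the permutation unitary `W` transports it
to an arbitrary finite type. -/
theorem cfc_mono_matrix (hf : IsStandardMonotone f) {A B : Matrix a a ℂ} (hA : A.PosDef)
    (hAB : A ≤ B) : cfc f A ≤ cfc f B := by
  have hB : B.PosDef := by simpa using hA.add_posSemidef (Matrix.le_iff.1 hAB)
  let e := Fintype.equivFin a
  let W : Matrix (Fin (Fintype.card a)) a ℂ := (1 : Matrix a a ℂ).submatrix e.symm id
  have hW : Wᴴ * W = 1 := by
    simp only [W, Matrix.conjTranspose_submatrix, Matrix.conjTranspose_one]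
    rw [Matrix.submatrix_mul_equiv]; simp
  have hW' : W * Wᴴ = 1 := by
    simp only [W, Matrix.conjTranspose_submatrix, Matrix.conjTranspose_one]
    rw [← Matrix.submatrix_mul _ _ _ _ _ Function.bijective_id]
    simp
  have hcfc : ∀ {C : Matrix a a ℂ}, C.IsHermitian → cfc f (W * C * Wᴴ) = W * cfc f C * Wᴴ := by
    intro C hC
    simpa [hW'] using cfc_isometry_conj hW hC 0 f
  have hpd : ∀ {C : Matrix a a ℂ}, C.PosDef → (W * C * Wᴴ).PosDef := by
    intro C hC
    obtain ⟨r, hr, hrC⟩ := exists_pos_smul_one_le hC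
    refine posDef_of_smul_one_le hr ?_
    simpa [hW'] using smul_one_le_isometry_conj W hrC
  have h := hf.monotone _ _ _ (hpd hA) (hpd hB)
    (Matrix.le_iff.1 (mul_mul_conjTranspose_mono hAB W))
  rw [hcfc hA.1, hcfc hB.1] at h
  have h2 := conjTranspose_mul_mul_mono (Matrix.le_iff.2 h) W
  have e3 : ∀ X : Matrix a a ℂ, Wᴴ * (W * X * Wᴴ) * W = X := by
    intro X
    calc _ = (Wᴴ * W) * X * (Wᴴ * W) := by simp only [Matrix.mul_assoc]
      _ = X := by simp [hW]
  rwa [e3, e3] at h2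

theorem le_of_le (hf : IsStandardMonotone f) {x y : ℝ} (hx : 0 < x) (hxy : x ≤ y) :
    f x ≤ f y := by
  have key : ∀ z : ℝ, cfc f (z • (1 : Matrix Unit Unit ℂ)) = f z • 1 := by
    intro z
    rw [← Algebra.algebraMap_eq_smul_one, cfc_algebraMap, Algebra.algebraMap_eq_smul_one]
  have h1 : (x • (1 : Matrix Unit Unit ℂ)).PosDef := Matrix.PosDef.one.smul hx
  have h2 : x • (1 : Matrix Unit Unit ℂ) ≤ y • 1 :=
    smul_le_smul_of_nonneg_right hxy Matrix.PosSemidef.one.nonneg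
  have h3 := hf.cfc_mono_matrix h1 h2
  rw [key, key, Matrix.le_iff] at h3
  have := h3.diag_nonneg (i := ())
  simpa [← Complex.ofReal_sub] using this

/-- By the symmetry, f(x)/x = f(x⁻¹), so f(x)/x is nonincreasing. -/
theorem apply_mul_le (hf : IsStandardMonotone f) {c x : ℝ} (hc : 1 ≤ c) (hx : 0 < x) :
    f (c * x) ≤ c * f x := by
  have hc0 : 0 < c := by linarith
  rw [hf.symm (c * x) (by positivity), hf.symm x hx, ← mul_assoc]
  refine mul_le_mul_of_nonneg_left (hf.le_of_le (by positivity) ?_) (by positivity)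
  exact inv_anti₀ hx (by nlinarith)

theorem cfc_smul_le (hf : IsStandardMonotone f) {c : ℝ} (hc : 1 ≤ c) {B : Matrix a a ℂ}
    (hB : B.PosDef) : cfc f (c • B) ≤ c • cfc f B := by
  have hsa : IsSelfAdjoint B := hB.1
  rw [← cfc_comp_const_mul c f B (Matrix.finite_real_spectrum.image _ |>.continuousOn _),
    ← cfc_const_mul c f B (continuousOn_spectrum B f)]
  exact cfc_mono (fun x hx => hf.apply_mul_le hc (hB.isStrictlyPositive.spectrum_pos hx))
    (continuousOn_spectrum B _) (continuousOn_spectrum B _)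

theorem posDef_cfc (hf : IsStandardMonotone f) {A : Matrix a a ℂ} (hA : A.PosDef) :
    (cfc f A).PosDef := by
  have hsa : IsSelfAdjoint A := hA.1
  rw [← Matrix.isStrictlyPositive_iff_posDef,
    cfc_isStrictlyPositive_iff f A (continuousOn_spectrum A f)]
  exact fun x hx => hf.pos x (hA.isStrictlyPositive.spectrum_pos hx)

/-- Hansen's inequality for contractions. -/
theorem conj_cfc_le (hf : IsStandardMonotone f) {A : Matrix a a ℂ} {B : Matrix b b ℂ}
    (hA : A.PosDef) (hB : B.PosDef) {V : Matrix a b ℂ} (hV : Vᴴ * V ≤ 1)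
    (hVAB : Vᴴ * A * V ≤ B) : Vᴴ * cfc f A * V ≤ cfc f B := by
  -- `D` is the defect of the contraction `V`: stacking `V` on `D` gives the isometry `W`, so `V`
  -- becomes a corner of an isometry.
  obtain ⟨D, hD⟩ : ∃ D : Matrix b b ℂ, Dᴴ * D = 1 - Vᴴ * V := by
    obtain ⟨D, hD⟩ := CStarAlgebra.nonneg_iff_eq_star_mul_self.mp (sub_nonneg.2 hV)
    exact ⟨D, hD.symm⟩
  have hDpos : (0 : Matrix b b ℂ) ≤ 1 - Vᴴ * V := sub_nonneg.2 hV
  let W : Matrix (a ⊕ b) b ℂ := Matrix.fromRows V D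
  let I : Matrix (a ⊕ b) a ℂ := Matrix.fromRows 1 0
  have hW : Wᴴ * W = 1 := by
    simp [W, Matrix.conjTranspose_fromRows_eq_fromCols_conjTranspose, Matrix.fromCols_mul_fromRows,
      hD]
  have hI : Iᴴ * I = 1 := by
    simp [I, Matrix.conjTranspose_fromRows_eq_fromCols_conjTranspose, Matrix.fromCols_mul_fromRows]
  have hWI : Wᴴ * I = Vᴴ := by
    simp [W, I, Matrix.conjTranspose_fromRows_eq_fromCols_conjTranspose,
      Matrix.fromCols_mul_fromRows]
  have hIW : Iᴴ * W = V := by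
    simpa using congrArg Matrix.conjTranspose hWI
  have hcomp : ∀ (X : Matrix a a ℂ) (l : ℝ),
      Wᴴ * (I * X * Iᴴ + l • (1 - I * Iᴴ)) * W = Vᴴ * X * V + l • (1 - Vᴴ * V) := by
    intro X l
    have e1 : Wᴴ * (I * X * Iᴴ) * W = Vᴴ * X * V := by
      calc _ = (Wᴴ * I) * X * (Iᴴ * W) := by simp only [Matrix.mul_assoc]
        _ = _ := by rw [hWI, hIW]
    have e2 : Wᴴ * (I * Iᴴ) * W = Vᴴ * V := by
      calc _ = (Wᴴ * I) * (Iᴴ * W) := by simp only [Matrix.mul_assoc]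
        _ = _ := by rw [hWI, hIW]
    rw [Matrix.mul_add, Matrix.add_mul, e1, Matrix.mul_smul, Matrix.smul_mul, Matrix.mul_sub,
      Matrix.sub_mul, e2, Matrix.mul_one, hW]
  -- One factor `c` pays for padding `A` to a positive definite matrix, the other for the pinching
  -- bound; both disappear as c → 1.
  have hscaled : ∀ c : ℝ, 1 < c → Vᴴ * cfc f A * V ≤ c • (c • cfc f B) := by
    intro c hc
    have hc0 : 0 < c := by linarith
    obtain ⟨r, hr, hrA⟩ := exists_pos_smul_one_le hA
    obtain ⟨s, hs, hsB⟩ := exists_pos_smul_one_le hB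
    -- The padding value `d` must be positive, so that the dilation stays positive definite, and
    -- small enough that d ≤ (c - 1) B.
    set d := min r ((c - 1) * s) with hd
    have hd0 : 0 < d := lt_min hr (mul_pos (by linarith) hs)
    have hone : (0 : Matrix a a ℂ) ≤ 1 := Matrix.PosSemidef.one.nonneg
    have hone' : (0 : Matrix b b ℂ) ≤ 1 := Matrix.PosSemidef.one.nonneg
    have hdA : d • (1 : Matrix a a ℂ) ≤ A :=
      (smul_le_smul_of_nonneg_right (min_le_left _ _) hone).trans hrA
    have hdB : d • (1 : Matrix b b ℂ) ≤ (c - 1) • B := by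
      refine (smul_le_smul_of_nonneg_right (min_le_right _ _) hone').trans ?_
      rw [mul_smul]
      exact smul_le_smul_of_nonneg_left hsB (by linarith)
    set A' := I * A * Iᴴ + d • (1 - I * Iᴴ) with hA'
    have hA'pd : A'.PosDef := posDef_of_smul_one_le hd0 (smul_one_le_isometry_conj I hdA)
    have hcA' : Wᴴ * A' * W ≤ c • B := by
      rw [hA', hcomp]
      have h1 : d • (1 - Vᴴ * V) ≤ d • (1 : Matrix b b ℂ) :=
        smul_le_smul_of_nonneg_left
          (sub_le_self _ (Matrix.posSemidef_conjTranspose_mul_self V).nonneg) hd0.le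
      calc _ ≤ B + (c - 1) • B := add_le_add hVAB (h1.trans hdB)
        _ = c • B := by rw [sub_smul, one_smul]; abel
    obtain ⟨l, hl, hle⟩ := le_pinching hA'pd.posSemidef hc W hW
    have hle2 : A' ≤ W * (c • (c • B)) * Wᴴ + l • (1 - W * Wᴴ) :=
      hle.trans (add_le_add_left
        (mul_mul_conjTranspose_mono (smul_le_smul_of_nonneg_left hcA' hc0.le) W) _)
    have hcB : (c • B).PosDef := hB.smul hc0
    have h3 := conjTranspose_mul_mul_mono (hf.cfc_mono_matrix hA'pd hle2) W
    rw [hA', cfc_isometry_conj hI hA.1, hcomp, cfc_isometry_conj hW (hcB.smul hc0).1] at h3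
    have e : Wᴴ * (W * cfc f (c • c • B) * Wᴴ + f l • (1 - W * Wᴴ)) * W = cfc f (c • c • B) := by
      have e1 : Wᴴ * (W * cfc f (c • c • B) * Wᴴ) * W =
          (Wᴴ * W) * cfc f (c • c • B) * (Wᴴ * W) := by simp only [Matrix.mul_assoc]
      have e2 : Wᴴ * (1 - W * Wᴴ) = 0 := by
        rw [Matrix.mul_sub, ← Matrix.mul_assoc, hW]; simp
      rw [Matrix.mul_add, Matrix.add_mul, e1, hW, Matrix.mul_smul, e2]
      simp
    rw [e] at h3
    calc Vᴴ * cfc f A * V ≤ Vᴴ * cfc f A * V + f d • (1 - Vᴴ * V) :=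
          le_add_of_nonneg_right (smul_nonneg (hf.pos d hd0).le hDpos)
      _ ≤ _ := h3
      _ ≤ c • cfc f (c • B) := hf.cfc_smul_le hc.le hcB
      _ ≤ _ := smul_le_smul_of_nonneg_left (hf.cfc_smul_le hc.le hB) hc0.le
  rw [Matrix.le_iff, Matrix.posSemidef_iff_dotProduct_mulVec]
  have hgB := (hf.posDef_cfc hB).posSemidef
  have hgA := ((hf.posDef_cfc hA).posSemidef).conjTranspose_mul_mul_same V
  refine ⟨hgB.1.sub hgA.1, fun x => ?_⟩
  have hx : ∀ c : ℝ, 1 < c → star x ⬝ᵥ (Vᴴ * cfc f A * V) *ᵥ x ≤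
      ((c * c : ℝ) : ℂ) * (star x ⬝ᵥ cfc f B *ᵥ x) := by
    intro c hc
    have := (Matrix.le_iff.1 (hscaled c hc)).dotProduct_mulVec_nonneg x
    rw [smul_smul, Matrix.sub_mulVec, dotProduct_sub, Matrix.smul_mulVec, dotProduct_smul,
      sub_nonneg] at this
    simpa using this
  rw [Matrix.sub_mulVec, dotProduct_sub, sub_nonneg]
  have hcont : Filter.Tendsto (fun c : ℝ => ((c * c : ℝ) : ℂ) * (star x ⬝ᵥ cfc f B *ᵥ x))
      (nhdsWithin 1 (Set.Ioi 1)) (nhds (((1 * 1 : ℝ) : ℂ) * (star x ⬝ᵥ cfc f B *ᵥ x))) :=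
    (Continuous.tendsto (by fun_prop) (1 : ℝ)).mono_left nhdsWithin_le_nhds
  have := ge_of_tendsto hcont (Filter.eventually_of_mem self_mem_nhdsWithin hx)
  simpa using this

end IsStandardMonotone

end Jensen

/-! ### Superoperators as matrices on the basis of matrix units. -/

section Vectorization

set_option linter.unusedSectionVars false

open scoped MatrixOrder ComplexOrder Kronecker
open Matrix

variable {n m : Type*} [Fintype n] [DecidableEq n] [Fintype m] [DecidableEq m]

/-- The coordinates of a matrix in the basis of matrix units. -/
def vectorize (A : Matrix n n ℂ) : n × n → ℂ := fun p => A p.1 p.2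

theorem vectorize_injective : Function.Injective (vectorize (n := n)) := fun A B h => by
  ext i j
  exact congrFun h (i, j)

theorem exists_vectorize_eq (v : n × n → ℂ) : ∃ A : Matrix n n ℂ, vectorize A = v :=
  ⟨Matrix.of fun i j => v (i, j), rfl⟩

theorem star_vectorize_dotProduct (A B : Matrix n n ℂ) :
    star (vectorize A) ⬝ᵥ vectorize B = (Aᴴ * B).trace := by
  simp only [dotProduct, vectorize, Matrix.trace, Matrix.diag, Matrix.mul_apply,
    Matrix.conjTranspose_apply, Fintype.sum_prod_type, Pi.star_apply]
  exact Finset.sum_comm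

/-- The matrix of a superoperator in the bases of matrix units. -/
def superMatrix (Φ : Matrix n n ℂ →ₗ[ℂ] Matrix m m ℂ) : Matrix (m × m) (n × n) ℂ :=
  Matrix.of fun p q => Φ (Matrix.single q.1 q.2 1) p.1 p.2

theorem vectorize_map (Φ : Matrix n n ℂ →ₗ[ℂ] Matrix m m ℂ) (A : Matrix n n ℂ) :
    vectorize (Φ A) = superMatrix Φ *ᵥ vectorize A := by
  ext p
  conv_lhs => rw [Matrix.matrix_eq_sum_single A]
  have h : ∀ i j, Matrix.single i j (A i j) = A i j • Matrix.single i j (1 : ℂ) := by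
    intro i j
    simp [Matrix.smul_single]
  simp only [h, map_sum, map_smul, vectorize, superMatrix, Matrix.mulVec, dotProduct,
    Matrix.of_apply, Fintype.sum_prod_type, Matrix.sum_apply, Matrix.smul_apply, smul_eq_mul]
  exact Finset.sum_congr rfl fun i _ => Finset.sum_congr rfl fun j _ => mul_comm _ _

theorem vectorize_hsAdjoint (Φ : Matrix n n ℂ →ₗ[ℂ] Matrix m m ℂ) (B : Matrix m m ℂ) :
    vectorize (hsAdjoint Φ B) = (superMatrix Φ)ᴴ *ᵥ vectorize B := by
  ext p
  simp only [vectorize, hsAdjoint, LinearMap.coe_mk, AddHom.coe_mk, Matrix.of_apply,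
    Matrix.mulVec, dotProduct, Matrix.conjTranspose_apply, superMatrix, Matrix.trace,
    Matrix.diag, Matrix.mul_apply, Fintype.sum_prod_type]
  exact Finset.sum_comm

theorem vectorize_superop (M : Matrix (n × n) (n × n) ℂ) (A : Matrix n n ℂ) :
    vectorize (superop M A) = M *ᵥ vectorize A := rfl

/-- The matrix of right multiplication by `A`. -/
def rightMul (A : Matrix n n ℂ) : Matrix (n × n) (n × n) ℂ := (1 : Matrix n n ℂ) ⊗ₖ A.transpose

/-- The matrix of left multiplication by `A`. -/
def leftMul (A : Matrix n n ℂ) : Matrix (n × n) (n × n) ℂ := A ⊗ₖ (1 : Matrix n n ℂ)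

theorem vectorize_mul_right (A B : Matrix n n ℂ) :
    vectorize (A * B) = rightMul B *ᵥ vectorize A := by
  ext p
  simp [vectorize, rightMul, Matrix.mulVec, dotProduct, Matrix.mul_apply, Fintype.sum_prod_type,
    Matrix.one_apply, mul_comm]

theorem vectorize_mul_left (A B : Matrix n n ℂ) :
    vectorize (A * B) = leftMul A *ᵥ vectorize B := by
  ext p
  simp [vectorize, leftMul, Matrix.mulVec, dotProduct, Matrix.mul_apply, Fintype.sum_prod_type,
    Matrix.one_apply]

theorem rightMul_mul (A B : Matrix n n ℂ) : rightMul A * rightMul B = rightMul (B * A) := by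
  simp [rightMul, ← Matrix.mul_kronecker_mul]

theorem leftMul_mul (A B : Matrix n n ℂ) : leftMul A * leftMul B = leftMul (A * B) := by
  simp [leftMul, ← Matrix.mul_kronecker_mul]

theorem leftMul_mul_rightMul (A B : Matrix n n ℂ) : leftMul A * rightMul B = A ⊗ₖ Bᵀ := by
  simp [leftMul, rightMul, ← Matrix.mul_kronecker_mul]

theorem commute_leftMul_rightMul (A B : Matrix n n ℂ) : Commute (leftMul A) (rightMul B) := by
  simp [Commute, SemiconjBy, leftMul, rightMul, ← Matrix.mul_kronecker_mul]

theorem rightMul_one : rightMul (1 : Matrix n n ℂ) = 1 := by simp [rightMul]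

theorem leftMul_one : leftMul (1 : Matrix n n ℂ) = 1 := by simp [leftMul]

theorem modular_eq (π : Matrix n n ℂ) : modular π = leftMul π * rightMul π⁻¹ :=
  (leftMul_mul_rightMul _ _).symm

theorem posDef_rightMul {A : Matrix n n ℂ} (hA : A.PosDef) : (rightMul A).PosDef :=
  Matrix.PosDef.one.kronecker hA.transpose

theorem posDef_leftMul {A : Matrix n n ℂ} (hA : A.PosDef) : (leftMul A).PosDef :=
  hA.kronecker Matrix.PosDef.one

theorem posDef_modular {A : Matrix n n ℂ} (hA : A.PosDef) : (modular A).PosDef :=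
  hA.kronecker hA.inv.transpose

theorem mul_inv_of_posDef {A : Matrix n n ℂ} (hA : A.PosDef) : A * A⁻¹ = 1 :=
  Matrix.mul_nonsing_inv _ ((Matrix.isUnit_iff_isUnit_det _).1 hA.isUnit)

theorem inv_mul_of_posDef {A : Matrix n n ℂ} (hA : A.PosDef) : A⁻¹ * A = 1 :=
  Matrix.nonsing_inv_mul _ ((Matrix.isUnit_iff_isUnit_det _).1 hA.isUnit)

theorem rightMul_inv {A : Matrix n n ℂ} (hA : A.PosDef) : (rightMul A)⁻¹ = rightMul A⁻¹ :=
  Matrix.inv_eq_right_inv (by rw [rightMul_mul, inv_mul_of_posDef hA, rightMul_one])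

theorem leftMul_inv {A : Matrix n n ℂ} (hA : A.PosDef) : (leftMul A)⁻¹ = leftMul A⁻¹ :=
  Matrix.inv_eq_right_inv (by rw [leftMul_mul, mul_inv_of_posDef hA, leftMul_one])

/-- `B` commutes with A⁻¹ as well, so right multiplication by `B` commutes with the self-adjoint
modular matrix and hence with its functional calculus. -/
theorem commute_cfc_modular_rightMul (f : ℝ → ℝ) {A B : Matrix n n ℂ} (hA : A.PosDef)
    (h : Commute A B) : Commute (cfc f (modular A)) (rightMul B) := by
  have h1 : Commute (modular A) (rightMul B) := by
    rw [modular_eq]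
    refine (commute_leftMul_rightMul A B).mul_left ?_
    rw [Commute, SemiconjBy, rightMul_mul, rightMul_mul]
    congr 1
    have h2 := congrArg (fun X => A⁻¹ * X * A⁻¹) h.eq
    simp only [← Matrix.mul_assoc, inv_mul_of_posDef hA, Matrix.one_mul] at h2
    simp only [Matrix.mul_assoc, mul_inv_of_posDef hA, Matrix.mul_one] at h2
    exact h2
  refine Commute.cfc h1 ?_ f
  rw [Matrix.star_eq_conjTranspose, (posDef_modular hA).1.eq]
  exact h1

/-- The matrix of the quantum Fisher operator. -/
noncomputable def fisherMatrix (f : ℝ → ℝ) (π : Matrix n n ℂ) : Matrix (n × n) (n × n) ℂ :=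
  rightMul π * cfc f (modular π)

theorem vectorize_J (f : ℝ → ℝ) (π A : Matrix n n ℂ) :
    vectorize (J f π A) = fisherMatrix f π *ᵥ vectorize A := by
  simp only [J, LinearMap.comp_apply, LinearMap.mulRight_apply, vectorize_mul_right,
    vectorize_superop, fisherMatrix, Matrix.mulVec_mulVec]

theorem cfc_inv_mul_cfc {f : ℝ → ℝ} (hf : IsStandardMonotone f) {A : Matrix n n ℂ}
    (hA : A.PosDef) : cfc (fun x => 1 / f x) A * cfc f A = 1 := by
  have hsa : IsSelfAdjoint A := hA.1
  rw [← cfc_mul _ _ A (continuousOn_spectrum A _) (continuousOn_spectrum A _)]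
  rw [cfc_congr (g := fun _ => (1 : ℝ)) fun x hx =>
    one_div_mul_cancel (hf.pos x (hA.isStrictlyPositive.spectrum_pos hx)).ne']
  exact cfc_const_one ℝ A

theorem inv_fisherMatrix {f : ℝ → ℝ} (hf : IsStandardMonotone f) {π : Matrix n n ℂ}
    (hπ : π.PosDef) :
    (fisherMatrix f π)⁻¹ = rightMul π⁻¹ * cfc (fun x => 1 / f x) (modular π) := by
  refine Matrix.inv_eq_left_inv ?_
  have h := commute_cfc_modular_rightMul (fun x => 1 / f x) hπ (Commute.refl π)
  calc _ = rightMul π⁻¹ * (cfc (fun x => 1 / f x) (modular π) * rightMul π) *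
        cfc f (modular π) := by simp only [fisherMatrix, Matrix.mul_assoc]
    _ = (rightMul π⁻¹ * rightMul π) * (cfc (fun x => 1 / f x) (modular π) *
        cfc f (modular π)) := by rw [h.eq]; simp only [Matrix.mul_assoc]
    _ = 1 := by
      rw [rightMul_mul, mul_inv_of_posDef hπ, rightMul_one,
        cfc_inv_mul_cfc hf (posDef_modular hπ), Matrix.one_mul]

theorem vectorize_Jinv {f : ℝ → ℝ} (hf : IsStandardMonotone f) {π : Matrix n n ℂ}
    (hπ : π.PosDef) (A : Matrix n n ℂ) :
    vectorize (Jinv f π A) = (fisherMatrix f π)⁻¹ *ᵥ vectorize A := by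
  simp only [Jinv, LinearMap.comp_apply, LinearMap.mulRight_apply, vectorize_mul_right,
    vectorize_superop, inv_fisherMatrix hf hπ, Matrix.mulVec_mulVec]

theorem exists_posDef_sqrt {A : Matrix n n ℂ} (hA : A.PosDef) :
    ∃ S : Matrix n n ℂ, S.PosDef ∧ S * S = A := by
  have hsq : CFC.sqrt A * CFC.sqrt A = A := CFC.sqrt_mul_sqrt_self A hA.posSemidef.nonneg
  refine ⟨CFC.sqrt A, ?_, hsq⟩
  have h1 : (CFC.sqrt A).PosSemidef := (CFC.sqrt_nonneg A).posSemidef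
  refine h1.posDef_iff_isUnit.2 ?_
  have := hA.isUnit
  rw [← hsq] at this
  exact isUnit_of_mul_isUnit_left this

/-- `fisherMatrix f π` as a congruence of `cfc f (modular π)`. -/
theorem fisherMatrix_eq_conj (f : ℝ → ℝ) {π S : Matrix n n ℂ} (hπ : π.PosDef) (hS : S * S = π) :
    fisherMatrix f π = rightMul S * cfc f (modular π) * rightMul S := by
  have hc : Commute π S := by rw [← hS, Commute, SemiconjBy, Matrix.mul_assoc]
  rw [Matrix.mul_assoc, (commute_cfc_modular_rightMul f hπ hc).eq, ← Matrix.mul_assoc,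
    rightMul_mul, hS, fisherMatrix]

/-- This is the case f = id, in which the mean of L and R is L itself. -/
theorem rightMul_mul_modular_mul_rightMul {π S : Matrix n n ℂ} (hπ : π.PosDef)
    (hS : S * S = π) : rightMul S * modular π * rightMul S = leftMul π := by
  have hsa : IsSelfAdjoint (modular π) := (posDef_modular hπ).1
  have h := fisherMatrix_eq_conj id hπ hS
  rw [fisherMatrix, cfc_id ℝ (modular π)] at h
  rw [← h, modular_eq, (commute_leftMul_rightMul π π⁻¹).eq, ← Matrix.mul_assoc, rightMul_mul,
    inv_mul_of_posDef hπ, rightMul_one, Matrix.one_mul]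

theorem posDef_fisherMatrix {f : ℝ → ℝ} (hf : IsStandardMonotone f) {π : Matrix n n ℂ}
    (hπ : π.PosDef) : (fisherMatrix f π).PosDef := by
  obtain ⟨S, hS, hSS⟩ := exists_posDef_sqrt hπ
  rw [fisherMatrix_eq_conj f hπ hSS]
  have hR := posDef_rightMul hS
  have h := (hf.posDef_cfc (posDef_modular hπ)).conjTranspose_mul_mul_same
    (B := rightMul S) (Matrix.mulVec_injective_of_isUnit hR.isUnit)
  rwa [hR.1.eq] at h

end Vectorization

/-! ### Monotonicity of the Fisher metrics under channels. -/

section Monotonicity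

set_option linter.unusedSectionVars false

open scoped MatrixOrder ComplexOrder Kronecker
open Matrix

variable {n m : Type*} [Fintype n] [DecidableEq n] [Fintype m] [DecidableEq m]

/-- Both inequalities are Schur complement conditions for the same block matrix with diagonal blocks
`Q` and `P⁻¹` and off-diagonal block `K`. -/
theorem conj_le_iff_conj_inv_le {P : Matrix n n ℂ} {Q : Matrix m m ℂ} (hP : P.PosDef)
    (hQ : Q.PosDef) (K : Matrix m n ℂ) : K * P * Kᴴ ≤ Q ↔ Kᴴ * Q⁻¹ * K ≤ P⁻¹ := by
  let := hQ.isUnit.invertible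
  let := hP.inv.isUnit.invertible
  rw [Matrix.le_iff, Matrix.le_iff, ← Matrix.PosDef.fromBlocks₁₁ K P⁻¹ hQ,
    Matrix.PosDef.fromBlocks₂₂ Q K hP.inv,
    Matrix.nonsing_inv_nonsing_inv P ((Matrix.isUnit_iff_isUnit_det _).1 hP.isUnit)]

/-- Apply Hansen's inequality to V = S K* S'⁻¹: `h1` makes `V` a contraction and `h2` says V* D V ≤
D'. This transfers bounds on two matrices to their operator mean. -/
theorem conj_cfc_conj_le {f : ℝ → ℝ} (hf : IsStandardMonotone f) {D S : Matrix n n ℂ}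
    {D' S' : Matrix m m ℂ} (hD : D.PosDef) (hD' : D'.PosDef) (hS : S.IsHermitian)
    (hS' : S'.PosDef) {K : Matrix m n ℂ} (h1 : K * (S * S) * Kᴴ ≤ S' * S')
    (h2 : K * (S * D * S) * Kᴴ ≤ S' * D' * S') :
    K * (S * cfc f D * S) * Kᴴ ≤ S' * cfc f D' * S' := by
  have hT : (S'⁻¹)ᴴ = S'⁻¹ := hS'.inv.1.eq
  have hl := inv_mul_of_posDef hS'
  have hr := mul_inv_of_posDef hS'
  have e : ∀ X : Matrix n n ℂ, (S * Kᴴ * S'⁻¹)ᴴ * X * (S * Kᴴ * S'⁻¹) =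
      (S'⁻¹)ᴴ * (K * (S * X * S) * Kᴴ) * S'⁻¹ := by
    intro X
    simp only [Matrix.conjTranspose_mul, Matrix.conjTranspose_conjTranspose, hS.eq,
      Matrix.mul_assoc]
  have e' : ∀ X : Matrix m m ℂ, (S'⁻¹)ᴴ * (S' * X * S') * S'⁻¹ = X := by
    intro X
    rw [hT]
    calc _ = (S'⁻¹ * S') * X * (S' * S'⁻¹) := by simp only [Matrix.mul_assoc]
      _ = X := by rw [hl, hr]; simp
  have h3 := hf.conj_cfc_le (V := S * Kᴴ * S'⁻¹) hD hD' ?_ ?_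
  · rw [e] at h3
    have h4 := conjTranspose_mul_mul_mono h3 S'
    have e3 : ∀ X : Matrix m m ℂ, S'ᴴ * ((S'⁻¹)ᴴ * X * S'⁻¹) * S' = X := by
      intro X
      rw [hT, hS'.1.eq]
      calc _ = (S' * S'⁻¹) * X * (S'⁻¹ * S') := by simp only [Matrix.mul_assoc]
        _ = X := by rw [hl, hr]; simp
    rwa [e3, hS'.1.eq] at h4
  · have := conjTranspose_mul_mul_mono h1 S'⁻¹
    have h5 := e 1
    have h6 := e' 1
    simp only [Matrix.mul_one] at h5 h6
    rwa [h6, ← h5] at this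
  · have := conjTranspose_mul_mul_mono h2 S'⁻¹
    rwa [e', ← e] at this

namespace IsCompletelyPositive

variable {Φ : Matrix n n ℂ →ₗ[ℂ] Matrix m m ℂ}

theorem fromBlocks_map (hΦ : IsCompletelyPositive Φ) {X A Z : Matrix n n ℂ}
    (h : (Matrix.fromBlocks X A Aᴴ Z).PosSemidef) :
    (Matrix.fromBlocks (Φ X) (Φ A) (Φ Aᴴ) (Φ Z)).PosSemidef := by
  let u : Fin 2 × n → n ⊕ n := fun p => if p.1 = 0 then Sum.inl p.2 else Sum.inr p.2
  let w : m ⊕ m → Fin 2 × m := Sum.elim (fun x => (0, x)) (fun x => (1, x))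
  have h1 := (hΦ 2 _ (h.submatrix u)).submatrix w
  convert h1 using 1
  ext i j
  rcases i with i | i <;> rcases j with j | j <;>
    simp only [Matrix.fromBlocks_apply₁₁, Matrix.fromBlocks_apply₁₂, Matrix.fromBlocks_apply₂₁,
      Matrix.fromBlocks_apply₂₂, Matrix.submatrix_apply, w, u, Sum.elim_inl, Sum.elim_inr,
      Matrix.of_apply, if_true, one_ne_zero, if_false] <;> rfl

theorem map_conjTranspose (hΦ : IsCompletelyPositive Φ) (A : Matrix n n ℂ) :
    Φ Aᴴ = (Φ A)ᴴ := by
  have h : (Matrix.fromBlocks (A * Aᴴ) A Aᴴ 1).PosSemidef := by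
    let : Invertible (1 : Matrix n n ℂ) := invertibleOne
    rw [Matrix.PosDef.fromBlocks₂₂ _ _ Matrix.PosDef.one]
    simpa using Matrix.PosSemidef.zero
  have h1 := (hΦ.fromBlocks_map h).1
  rw [Matrix.isHermitian_fromBlocks_iff] at h1
  exact h1.2.1.symm

end IsCompletelyPositive

/-- The block matrix with corners A ρ⁻¹ A* and ρ has zero Schur complement. Its image under Φ is
positive, so the new Schur complement has nonnegative trace, and Φ preserves the trace of the first
corner. -/
theorem IsCPTP.trace_map_mul_inv_mul_le {Φ : Matrix n n ℂ →ₗ[ℂ] Matrix m m ℂ} (hΦ : IsCPTP Φ)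
    {ρ : Matrix n n ℂ} (hρ : ρ.PosDef) (hΦρ : (Φ ρ).PosDef) (A : Matrix n n ℂ) :
    (Φ A * (Φ ρ)⁻¹ * (Φ A)ᴴ).trace ≤ (A * ρ⁻¹ * Aᴴ).trace := by
  let := hρ.isUnit.invertible
  let := hΦρ.isUnit.invertible
  have h : (Matrix.fromBlocks (A * ρ⁻¹ * Aᴴ) A Aᴴ ρ).PosSemidef := by
    rw [Matrix.PosDef.fromBlocks₂₂ _ _ hρ, sub_self]
    exact Matrix.PosSemidef.zero
  have h1 := hΦ.1.fromBlocks_map h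
  rw [hΦ.1.map_conjTranspose, Matrix.PosDef.fromBlocks₂₂ _ _ hΦρ] at h1
  have h2 := h1.trace_nonneg
  rwa [Matrix.trace_sub, hΦ.2, sub_nonneg] at h2

theorem le_of_trace_le {M : Matrix (m × m) (m × m) ℂ} {N : Matrix (n × n) (n × n) ℂ}
    (hM : M.IsHermitian) (hN : N.IsHermitian) (Φ : Matrix n n ℂ →ₗ[ℂ] Matrix m m ℂ)
    (h : ∀ A : Matrix n n ℂ, star (vectorize (Φ A)) ⬝ᵥ M *ᵥ vectorize (Φ A) ≤
      star (vectorize A) ⬝ᵥ N *ᵥ vectorize A) :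
    (superMatrix Φ)ᴴ * M * superMatrix Φ ≤ N := by
  rw [Matrix.le_iff, Matrix.posSemidef_iff_dotProduct_mulVec]
  refine ⟨hN.sub (Matrix.isHermitian_conjTranspose_mul_mul _ hM), fun x => ?_⟩
  obtain ⟨A, rfl⟩ := exists_vectorize_eq x
  have h1 := h A
  rw [Matrix.sub_mulVec, dotProduct_sub, sub_nonneg]
  convert h1 using 1
  rw [vectorize_map, ← Matrix.mulVec_mulVec, ← Matrix.mulVec_mulVec, Matrix.star_mulVec,
    Matrix.dotProduct_mulVec _ (superMatrix Φ)ᴴ]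

/-- Monotonicity of the quantum Fisher metrics under quantum channels. -/
theorem IsCPTP.conj_inv_fisherMatrix_le {Φ : Matrix n n ℂ →ₗ[ℂ] Matrix m m ℂ} (hΦ : IsCPTP Φ)
    {ρ : Matrix n n ℂ} (hρ : ρ.PosDef) (hΦρ : (Φ ρ).PosDef) {f : ℝ → ℝ}
    (hf : IsStandardMonotone f) :
    (superMatrix Φ)ᴴ * (fisherMatrix f (Φ ρ))⁻¹ * superMatrix Φ ≤ (fisherMatrix f ρ)⁻¹ := by
  have hR : superMatrix Φ * rightMul ρ * (superMatrix Φ)ᴴ ≤ rightMul (Φ ρ) := by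
    rw [conj_le_iff_conj_inv_le (posDef_rightMul hρ) (posDef_rightMul hΦρ), rightMul_inv hρ,
      rightMul_inv hΦρ]
    refine le_of_trace_le (posDef_rightMul hΦρ.inv).1 (posDef_rightMul hρ.inv).1 Φ fun A => ?_
    rw [← vectorize_mul_right, ← vectorize_mul_right, star_vectorize_dotProduct,
      star_vectorize_dotProduct, Matrix.trace_mul_comm, Matrix.trace_mul_comm Aᴴ]
    exact hΦ.trace_map_mul_inv_mul_le hρ hΦρ A
  have hL : superMatrix Φ * leftMul ρ * (superMatrix Φ)ᴴ ≤ leftMul (Φ ρ) := by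
    rw [conj_le_iff_conj_inv_le (posDef_leftMul hρ) (posDef_leftMul hΦρ), leftMul_inv hρ,
      leftMul_inv hΦρ]
    refine le_of_trace_le (posDef_leftMul hΦρ.inv).1 (posDef_leftMul hρ.inv).1 Φ fun A => ?_
    rw [← vectorize_mul_left, ← vectorize_mul_left, star_vectorize_dotProduct,
      star_vectorize_dotProduct]
    have := hΦ.trace_map_mul_inv_mul_le hρ hΦρ Aᴴ
    simpa [hΦ.1.map_conjTranspose, Matrix.mul_assoc] using this
  rw [← conj_le_iff_conj_inv_le (posDef_fisherMatrix hf hρ) (posDef_fisherMatrix hf hΦρ)]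
  obtain ⟨S, hS, hSS⟩ := exists_posDef_sqrt hρ
  obtain ⟨S', hS', hSS'⟩ := exists_posDef_sqrt hΦρ
  rw [fisherMatrix_eq_conj f hρ hSS, fisherMatrix_eq_conj f hΦρ hSS']
  refine conj_cfc_conj_le hf (posDef_modular hρ) (posDef_modular hΦρ) (posDef_rightMul hS).1
    (posDef_rightMul hS') ?_ ?_
  · rwa [rightMul_mul, rightMul_mul, hSS, hSS']
  · rwa [rightMul_mul_modular_mul_rightMul hρ hSS, rightMul_mul_modular_mul_rightMul hΦρ hSS']

end Monotonicity

/-! ### Fixed vectors and spectrum of the modular operator. -/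

section Commuting

set_option linter.unusedSectionVars false

open scoped MatrixOrder ComplexOrder Kronecker
open Matrix

variable {n m : Type*} [Fintype n] [DecidableEq n] [Fintype m] [DecidableEq m]

theorem cfc_sub_const {D : Matrix n n ℂ} (hD : D.IsHermitian) (h : ℝ → ℝ) (c : ℝ) :
    cfc (fun x => h x - c) D = cfc h D - c • 1 := by
  have hsa : IsSelfAdjoint D := hD
  rw [cfc_sub h (fun _ => c) D (continuousOn_spectrum D _) (continuousOn_spectrum D _),
    cfc_const c D, Algebra.algebraMap_eq_smul_one]

theorem cfc_mulVec_eq_smul {D : Matrix n n ℂ} (hD : D.IsHermitian) {v : n → ℂ}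
    (hv : D *ᵥ v = v) (h : ℝ → ℝ) : cfc h D *ᵥ v = h 1 • v := by
  have hsa : IsSelfAdjoint D := hD
  have h1 : cfc h D - h 1 • 1 = cfc (fun x => (h x - h 1) / (x - 1)) D * (D - (1 : ℝ) • 1) := by
    have h2 := cfc_sub_const hD id 1
    rw [cfc_id ℝ D] at h2
    rw [← cfc_sub_const hD, ← h2,
      ← cfc_mul _ _ D (continuousOn_spectrum D _) (continuousOn_spectrum D _)]
    refine cfc_congr fun x _ => ?_
    rcases eq_or_ne x 1 with rfl | hx
    · simp
    · simp [div_mul_cancel₀ _ (sub_ne_zero.2 hx)]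
  have h3 := congrArg (fun M => M *ᵥ v) h1
  simp only [Matrix.sub_mulVec, ← Matrix.mulVec_mulVec, hv, Matrix.smul_mulVec, Matrix.one_mulVec,
    one_smul, sub_self, Matrix.mulVec_zero] at h3
  exact sub_eq_zero.1 h3

/-- On the spectrum, x - 1 is a multiple of g(x) - h(x), so whatever g(D) - h(D) annihilates is
annihilated by D - 1. -/
theorem mulVec_eq_self_of_cfc_mulVec_eq {D : Matrix n n ℂ} (hD : D.IsHermitian) {v : n → ℂ}
    {g h : ℝ → ℝ} (hgh : ∀ x ∈ spectrum ℝ D, x ≠ 1 → g x ≠ h x)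
    (hv : cfc g D *ᵥ v = cfc h D *ᵥ v) : D *ᵥ v = v := by
  have hsa : IsSelfAdjoint D := hD
  have h1 : D - (1 : ℝ) • 1 = cfc (fun x => (x - 1) / (g x - h x)) D * (cfc g D - cfc h D) := by
    have h2 := cfc_sub_const hD id 1
    rw [cfc_id ℝ D] at h2
    rw [← h2, ← cfc_sub g h D (continuousOn_spectrum D _) (continuousOn_spectrum D _),
      ← cfc_mul _ _ D (continuousOn_spectrum D _) (continuousOn_spectrum D _)]
    refine cfc_congr fun x hx => ?_
    rcases eq_or_ne x 1 with rfl | hx1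
    · simp
    · simp [div_mul_cancel₀ _ (sub_ne_zero.2 (hgh x hx hx1))]
  have h3 := congrArg (fun M => M *ᵥ v) h1
  simp only [Matrix.sub_mulVec, ← Matrix.mulVec_mulVec, hv, Matrix.one_mulVec,
    one_smul, sub_self, Matrix.mulVec_zero] at h3
  exact sub_eq_zero.1 h3

theorem modular_mulVec_eq_self_iff {π : Matrix n n ℂ} (hπ : π.PosDef) (A : Matrix n n ℂ) :
    modular π *ᵥ vectorize A = vectorize A ↔ π * A = A * π := by
  rw [← vectorize_superop, superop_modular, vectorize_injective.eq_iff]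
  constructor <;> intro h
  · have := congrArg (fun X => X * π) h
    simpa [Matrix.mul_assoc, inv_mul_of_posDef hπ] using this
  · rw [h, Matrix.mul_assoc, mul_inv_of_posDef hπ, Matrix.mul_one]

theorem superop_cfc_modular_of_commute {π : Matrix n n ℂ} (hπ : π.PosDef) {A : Matrix n n ℂ}
    (hA : π * A = A * π) (h : ℝ → ℝ) : superop (cfc h (modular π)) A = h 1 • A := by
  apply vectorize_injective
  rw [vectorize_superop, cfc_mulVec_eq_smul (posDef_modular hπ).1
    ((modular_mulVec_eq_self_iff hπ A).2 hA)]
  rfl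

theorem J_of_commute {f : ℝ → ℝ} (hf : f 1 = 1) {π : Matrix n n ℂ} (hπ : π.PosDef)
    {A : Matrix n n ℂ} (hA : π * A = A * π) : J f π A = A * π := by
  rw [J, LinearMap.comp_apply, superop_cfc_modular_of_commute hπ hA, hf, one_smul,
    LinearMap.mulRight_apply]

theorem Jinv_of_commute {f : ℝ → ℝ} (hf : f 1 = 1) {π : Matrix n n ℂ} (hπ : π.PosDef)
    {A : Matrix n n ℂ} (hA : π * A = A * π) : Jinv f π A = A * π⁻¹ := by
  rw [Jinv, LinearMap.comp_apply, superop_cfc_modular_of_commute hπ hA, hf, div_one, one_smul,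
    LinearMap.mulRight_apply]

theorem Jinv_self {f : ℝ → ℝ} (hf : f 1 = 1) {π : Matrix n n ℂ} (hπ : π.PosDef) :
    Jinv f π π = 1 := by
  rw [Jinv_of_commute hf hπ rfl, mul_inv_of_posDef hπ]

theorem exists_div_eq_of_mem_spectrum_modular {π : Matrix n n ℂ} (hπ : π.PosDef) {x : ℝ}
    (hx : x ∈ spectrum ℝ (modular π)) :
    ∃ a ∈ spectrum ℝ π, ∃ b ∈ spectrum ℝ π, x = a / b := by
  have hD := (posDef_modular hπ).1
  rw [hD.spectrum_real_eq_range_eigenvalues] at hx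
  obtain ⟨i, rfl⟩ := hx
  set x := hD.eigenvalues i
  obtain ⟨A, hA⟩ := exists_vectorize_eq (n := n) (⇑(hD.eigenvectorBasis i))
  have hA0 : A ≠ 0 := by
    rintro rfl
    apply (hD.eigenvectorBasis.toBasis.ne_zero i)
    ext p
    simpa [vectorize] using (congrFun hA p).symm
  have hmul : π * A = x • (A * π) := by
    have h1 := hD.mulVec_eigenvectorBasis i
    rw [← hA, ← vectorize_superop, superop_modular] at h1
    have h2 : π * A * π⁻¹ = x • A := vectorize_injective h1
    have h3 := congrArg (fun X => X * π) h2
    simpa [Matrix.mul_assoc, inv_mul_of_posDef hπ] using h3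
  have hspec := hπ.1.spectral_theorem
  set U : Matrix n n ℂ := (hπ.1.eigenvectorUnitary : Matrix n n ℂ) with hU
  set d := hπ.1.eigenvalues with hd
  have hUU : Uᴴ * U = 1 := Unitary.coe_star_mul_self hπ.1.eigenvectorUnitary
  have hUU' : U * Uᴴ = 1 := Unitary.coe_mul_star_self hπ.1.eigenvectorUnitary
  have hspec' : π = U * Matrix.diagonal (fun i => (d i : ℂ)) * Uᴴ := hspec
  -- In an eigenbasis of `π` the relation πA = xAπ reads d_j B_jk = x B_jk d_k, so any nonzero entry
  -- exhibits x as d_j / d_k.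
  have hB : Matrix.diagonal (fun i => (d i : ℂ)) * (Uᴴ * A * U) =
      x • ((Uᴴ * A * U) * Matrix.diagonal (fun i => (d i : ℂ))) := by
    have h1 := congrArg (fun X => Uᴴ * X * U) hmul
    have e1 : Uᴴ * (π * A) * U = Matrix.diagonal (fun i => (d i : ℂ)) * (Uᴴ * A * U) := by
      calc _ = Uᴴ * (U * Matrix.diagonal (fun i => (d i : ℂ)) * Uᴴ * A) * U := by rw [← hspec']
        _ = (Uᴴ * U) * Matrix.diagonal (fun i => (d i : ℂ)) * (Uᴴ * A * U) := by
          simp only [Matrix.mul_assoc]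
        _ = _ := by rw [hUU, Matrix.one_mul]
    have e2 : Uᴴ * (A * π) * U = (Uᴴ * A * U) * Matrix.diagonal (fun i => (d i : ℂ)) := by
      calc _ = Uᴴ * (A * (U * Matrix.diagonal (fun i => (d i : ℂ)) * Uᴴ)) * U := by rw [← hspec']
        _ = (Uᴴ * A * U) * Matrix.diagonal (fun i => (d i : ℂ)) * (Uᴴ * U) := by
          simp only [Matrix.mul_assoc]
        _ = _ := by rw [hUU, Matrix.mul_one]
    simp only [Matrix.mul_smul, Matrix.smul_mul] at h1
    rwa [e1, e2] at h1
  have hB0 : Uᴴ * A * U ≠ 0 := by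
    intro h
    apply hA0
    calc A = (U * Uᴴ) * A * (U * Uᴴ) := by rw [hUU']; simp
      _ = U * (Uᴴ * A * U) * Uᴴ := by simp only [Matrix.mul_assoc]
      _ = 0 := by rw [h]; simp
  obtain ⟨j, k, hjk⟩ : ∃ j k, (Uᴴ * A * U) j k ≠ 0 := by
    by_contra! hcon
    exact hB0 (Matrix.ext hcon)
  have hentry := congrFun (congrFun hB j) k
  rw [Matrix.diagonal_mul, Matrix.smul_apply, Matrix.mul_diagonal, Complex.real_smul,
    mul_left_comm, mul_comm ((d j : ℂ))] at hentry
  have hdx := mul_left_cancel₀ hjk hentry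
  have hdx' : d j = x * d k := by exact_mod_cast hdx
  refine ⟨d j, ?_, d k, ?_, ?_⟩
  · rw [hπ.1.spectrum_real_eq_range_eigenvalues]; exact ⟨j, rfl⟩
  · rw [hπ.1.spectrum_real_eq_range_eigenvalues]; exact ⟨k, rfl⟩
  · rw [hdx', mul_div_cancel_right₀ _ (hπ.eigenvalues_pos k).ne']

end Commuting

/-! ### The arithmetic and harmonic functions as test functions. -/

section ExtremalFunctions

open scoped MatrixOrder ComplexOrder
open Matrix

variable {n : Type*} [Fintype n] [DecidableEq n]

theorem inv_le_inv_of_posDef {A B : Matrix n n ℂ} (hA : A.PosDef) (hB : B.PosDef) (h : A ≤ B) :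
    B⁻¹ ≤ A⁻¹ := by
  simpa using (conj_le_iff_conj_inv_le hA hB 1).1 (by simpa using h)

theorem isStandardMonotone_arithmetic : IsStandardMonotone fun x => (1 + x) / 2 where
  pos x hx := by positivity
  monotone k A B hA hB h := by
    have key : ∀ C : Matrix (Fin k) (Fin k) ℂ, C.IsHermitian →
        cfc (fun x : ℝ => (1 + x) / 2) C = (1 / 2 : ℝ) • (C + (1 : ℝ) • 1) := by
      intro C hC
      have hsa : IsSelfAdjoint C := hC
      have h1 := cfc_sub_const hC id (-1)
      rw [cfc_id ℝ C] at h1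
      rw [neg_smul, sub_neg_eq_add] at h1
      rw [← h1, ← cfc_const_mul _ _ C (continuousOn_spectrum C _)]
      exact cfc_congr fun x _ => by simp; ring
    rw [key A hA.1, key B hB.1]
    have h2 := h.smul (show (0 : ℝ) ≤ 1 / 2 by norm_num)
    have e : (1 / 2 : ℝ) • (B + (1 : ℝ) • 1) - (1 / 2 : ℝ) • (A + (1 : ℝ) • 1) =
        (1 / 2 : ℝ) • (B - A) := by rw [← smul_sub, add_sub_add_right_eq_sub]
    rw [e]
    exact h2
  symm x hx := by field_simp; ring
  one := by norm_num

theorem isStandardMonotone_harmonic : IsStandardMonotone fun x => 2 * x / (1 + x) where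
  pos x hx := by positivity
  monotone k A B hA hB h := by
    have hpd : ∀ {C : Matrix (Fin k) (Fin k) ℂ}, C.PosDef → (C + 1).PosDef :=
      fun hC => hC.add Matrix.PosDef.one
    have key : ∀ C : Matrix (Fin k) (Fin k) ℂ, C.PosDef →
        cfc (fun x : ℝ => 2 * x / (1 + x)) C = (2 : ℝ) • 1 - (2 : ℝ) • (C + 1)⁻¹ := by
      intro C hC
      have hsa : IsSelfAdjoint C := hC.1
      have h1 := cfc_sub_const hC.1 id (-1)
      rw [cfc_id ℝ C, neg_smul, sub_neg_eq_add, one_smul] at h1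
      have h2 : (C + 1)⁻¹ = cfc (fun x : ℝ => (1 + x)⁻¹) C := by
        refine Matrix.inv_eq_right_inv ?_
        rw [← h1, ← cfc_mul _ _ C (continuousOn_spectrum C _) (continuousOn_spectrum C _)]
        rw [cfc_congr (g := fun _ => (1 : ℝ)) fun x hx => ?_]
        · exact cfc_const_one ℝ C
        · have := hC.isStrictlyPositive.spectrum_pos hx
          simp only [id, sub_neg_eq_add]
          rw [add_comm x 1]
          exact mul_inv_cancel₀ (by positivity)
      have h3 : cfc (fun x : ℝ => 2 * x / (1 + x)) C =
          cfc (fun x : ℝ => (-2) * (1 + x)⁻¹ - (-2)) C := by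
        refine cfc_congr fun x hx => ?_
        have := hC.isStrictlyPositive.spectrum_pos hx
        have h4 : (1 + x) ≠ 0 := by positivity
        field_simp
        ring
      rw [h3, cfc_sub_const hC.1, cfc_const_mul _ _ C (continuousOn_spectrum C _), ← h2]
      simp only [neg_smul]
      abel
    rw [key A hA, key B hB, sub_sub_sub_cancel_left, ← smul_sub]
    have h5 : A + 1 ≤ B + 1 := add_le_add_left (Matrix.le_iff.2 h) 1
    exact (Matrix.le_iff.1 (inv_le_inv_of_posDef (hpd hA) (hpd hB) h5)).smul
      (show (0 : ℝ) ≤ 2 by norm_num)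
  symm x hx := by field_simp; ring
  one := by norm_num

end ExtremalFunctions

/-! ### Adjoints and compositions of completely positive maps. -/

section Channels

set_option linter.unusedSectionVars false

open scoped MatrixOrder ComplexOrder Kronecker
open Matrix

variable {n m l : Type*} [Fintype n] [DecidableEq n] [Fintype m] [DecidableEq m]
  [Fintype l] [DecidableEq l]

theorem trace_mul_nonneg_of_posSemidef {A B : Matrix n n ℂ} (hA : A.PosSemidef)
    (hB : B.PosSemidef) : 0 ≤ (A * B).trace := by
  obtain ⟨C, hC⟩ := CStarAlgebra.nonneg_iff_eq_star_mul_self.mp hB.nonneg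
  rw [hC, Matrix.star_eq_conjTranspose, ← Matrix.mul_assoc, Matrix.trace_mul_comm,
    ← Matrix.mul_assoc]
  exact (hA.mul_mul_conjTranspose_same C).trace_nonneg

theorem IsCompletelyPositive.hsAdjoint_conjTranspose {Φ : Matrix n n ℂ →ₗ[ℂ] Matrix m m ℂ}
    (hΦ : IsCompletelyPositive Φ) (B : Matrix m m ℂ) :
    hsAdjoint Φ Bᴴ = (hsAdjoint Φ B)ᴴ := by
  ext i j
  simp only [hsAdjoint, LinearMap.coe_mk, AddHom.coe_mk, Matrix.of_apply,
    Matrix.conjTranspose_apply]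
  rw [← Matrix.trace_conjTranspose, Matrix.conjTranspose_mul, Matrix.conjTranspose_conjTranspose,
    ← hΦ.map_conjTranspose, Matrix.conjTranspose_single, star_one, Matrix.trace_mul_comm]

theorem IsCompletelyPositive.hsAdjoint {Φ : Matrix n n ℂ →ₗ[ℂ] Matrix m m ℂ}
    (hΦ : IsCompletelyPositive Φ) : IsCompletelyPositive (hsAdjoint Φ) := by
  intro k X hX
  rw [Matrix.posSemidef_iff_dotProduct_mulVec]
  constructor
  · ext p q
    simp only [Matrix.conjTranspose_apply, Matrix.of_apply]
    have h1 : (Matrix.of fun a b : m => X (p.1, a) (q.1, b)) =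
        (Matrix.of fun a b : m => X (q.1, a) (p.1, b))ᴴ := by
      ext a b
      simp only [Matrix.of_apply, Matrix.conjTranspose_apply]
      exact (hX.1.apply _ _).symm
    rw [h1, hΦ.hsAdjoint_conjTranspose]
    rfl
  · intro y
    -- The quadratic form of the blockwise adjoint at `y` equals the trace of `X` against the image
    -- under id ⊗ Φ of the rank-one matrix y y*; both factors are positive.
    have hZ := hΦ k _ (Matrix.posSemidef_vecMulVec_self_star y)
    have h2 := trace_mul_nonneg_of_posSemidef hZ hX
    convert h2 using 1
    have hblock : ∀ s t : Fin k,
        ∑ a : n, ∑ b : n, star (y (s, a)) * (QuantumFisher.hsAdjoint Φ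
          (Matrix.of fun i j : m => X (s, i) (t, j)) a b * y (t, b)) =
        ∑ i : m, ∑ j : m, Φ (Matrix.of fun a b : n => vecMulVec y (star y) (t, a) (s, b)) j i *
          X (s, i) (t, j) := by
      intro s t
      have h3 := trace_hsAdjoint Φ (Matrix.of fun a b : n => vecMulVec y (star y) (s, a) (t, b))
        (Matrix.of fun i j : m => X (s, i) (t, j))
      have h4 : (Matrix.of fun a b : n => vecMulVec y (star y) (s, a) (t, b))ᴴ =
          Matrix.of fun a b : n => vecMulVec y (star y) (t, a) (s, b) := by
        ext a b
        simp [vecMulVec_apply, mul_comm]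
      rw [← hΦ.map_conjTranspose, h4] at h3
      simp only [Matrix.trace, Matrix.diag, Matrix.mul_apply, Matrix.of_apply,
        vecMulVec_apply, Pi.star_apply] at h3
      rw [Finset.sum_comm] at h3
      rw [Finset.sum_comm (γ := m)] at h3
      simp only [vecMulVec_apply, Pi.star_apply]
      rw [← h3]
      exact Finset.sum_congr rfl fun a _ => Finset.sum_congr rfl fun b _ => by ring
    simp only [dotProduct, Matrix.mulVec, Finset.mul_sum, Matrix.trace, Matrix.diag,
      Matrix.mul_apply, Fintype.sum_prod_type, Matrix.of_apply, Pi.star_apply]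
    have hL : ∀ s : Fin k, (∑ a : n, ∑ t : Fin k, ∑ b : n, star (y (s, a)) *
        (QuantumFisher.hsAdjoint Φ (Matrix.of fun i j : m => X (s, i) (t, j)) a b * y (t, b))) =
        ∑ t : Fin k, ∑ a : n, ∑ b : n, star (y (s, a)) *
        (QuantumFisher.hsAdjoint Φ (Matrix.of fun i j : m => X (s, i) (t, j)) a b * y (t, b)) :=
      fun s => Finset.sum_comm
    simp only [hL, hblock]
    rw [Finset.sum_comm]
    refine Finset.sum_congr rfl fun t _ => ?_
    simp only [Finset.sum_comm (s := (Finset.univ : Finset m)) (t := (Finset.univ : Finset (Fin k)))]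
    refine Finset.sum_congr rfl fun s _ => ?_
    exact Finset.sum_comm

theorem IsCompletelyPositive.comp {Φ : Matrix n n ℂ →ₗ[ℂ] Matrix m m ℂ}
    {Ψ : Matrix m m ℂ →ₗ[ℂ] Matrix l l ℂ} (hΨ : IsCompletelyPositive Ψ)
    (hΦ : IsCompletelyPositive Φ) : IsCompletelyPositive (Ψ ∘ₗ Φ) :=
  fun k X hX => hΨ k _ (hΦ k X hX)

theorem isCompletelyPositive_conj (S : Matrix n n ℂ) :
    IsCompletelyPositive (LinearMap.mulLeft ℂ S ∘ₗ LinearMap.mulRight ℂ Sᴴ) := by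
  intro k X hX
  have h := hX.mul_mul_conjTranspose_same ((1 : Matrix (Fin k) (Fin k) ℂ) ⊗ₖ S)
  convert h using 1
  ext p q
  simp only [Matrix.conjTranspose_kronecker, Matrix.conjTranspose_one, LinearMap.comp_apply,
    LinearMap.mulLeft_apply, LinearMap.mulRight_apply, Matrix.of_apply, Matrix.mul_assoc]
  simp [Matrix.mul_apply, Fintype.sum_prod_type, Matrix.one_apply, Finset.mul_sum]

theorem hsAdjoint_one {Φ : Matrix n n ℂ →ₗ[ℂ] Matrix m m ℂ} (hΦ : IsCPTP Φ) :
    hsAdjoint Φ 1 = 1 := by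
  ext i j
  simp only [hsAdjoint, LinearMap.coe_mk, AddHom.coe_mk, Matrix.of_apply, Matrix.mul_one]
  rw [Matrix.trace_conjTranspose, hΦ.2]
  rcases eq_or_ne i j with rfl | h
  · simp
  · simp [Matrix.trace_single_eq_of_ne _ _ _ h, h]

/-- J_f⁻¹ is self-adjoint and sends π to 1. This is what makes the recovery map trace preserving. -/
theorem trace_mul_Jinv {f : ℝ → ℝ} (hf : IsStandardMonotone f) {π : Matrix n n ℂ}
    (hπ : π.PosDef) (A : Matrix n n ℂ) : (π * Jinv f π A).trace = A.trace := by
  have h := star_vectorize_dotProduct π (Jinv f π A)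
  rw [hπ.1.eq] at h
  have hF := (posDef_fisherMatrix hf hπ).inv.1
  rw [← h, vectorize_Jinv hf hπ, Matrix.dotProduct_mulVec, ← hF.eq, ← Matrix.star_mulVec,
    ← vectorize_Jinv hf hπ, Jinv_self hf.one hπ, star_vectorize_dotProduct]
  simp

end Channels

/-! ### Data processing, its equality case, and recovery. -/

section Divergence

set_option linter.unusedSectionVars false

open scoped MatrixOrder ComplexOrder Kronecker
open Matrix

variable {n m : Type*} [Fintype n] [DecidableEq n] [Fintype m] [DecidableEq m]

theorem chiSq_eq_re_dotProduct {f : ℝ → ℝ} (hf : IsStandardMonotone f) {ρ σ : Matrix n n ℂ}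
    (hρ : ρ.PosDef) (hσ : σ.IsHermitian) :
    chiSq f ρ σ =
      (star (vectorize (ρ - σ)) ⬝ᵥ (fisherMatrix f ρ)⁻¹ *ᵥ vectorize (ρ - σ)).re := by
  rw [← vectorize_Jinv hf hρ, star_vectorize_dotProduct, (hρ.1.sub hσ).eq, chiSq]

theorem chiSq_sub_chiSq_map {f : ℝ → ℝ} (hf : IsStandardMonotone f)
    {Φ : Matrix n n ℂ →ₗ[ℂ] Matrix m m ℂ} (hΦ : IsCPTP Φ) {ρ σ : Matrix n n ℂ}
    (hρ : ρ.PosDef) (hΦρ : (Φ ρ).PosDef) (hσ : σ.IsHermitian) :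
    chiSq f ρ σ - chiSq f (Φ ρ) (Φ σ) =
      (star (vectorize (ρ - σ)) ⬝ᵥ ((fisherMatrix f ρ)⁻¹ - (superMatrix Φ)ᴴ *
        (fisherMatrix f (Φ ρ))⁻¹ * superMatrix Φ) *ᵥ vectorize (ρ - σ)).re := by
  have hΦσ : (Φ σ).IsHermitian := by
    rw [Matrix.IsHermitian, ← hΦ.1.map_conjTranspose, hσ.eq]
  rw [chiSq_eq_re_dotProduct hf hρ hσ, chiSq_eq_re_dotProduct hf hΦρ hΦσ, ← map_sub,
    vectorize_map, Matrix.sub_mulVec, dotProduct_sub, Complex.sub_re, ← Matrix.mulVec_mulVec,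
    ← Matrix.mulVec_mulVec, Matrix.star_mulVec, Matrix.dotProduct_mulVec _ (superMatrix Φ)ᴴ]

/-- The data processing inequality for the `χ²_f` divergences. -/
theorem chiSq_map_le {f : ℝ → ℝ} (hf : IsStandardMonotone f)
    {Φ : Matrix n n ℂ →ₗ[ℂ] Matrix m m ℂ} (hΦ : IsCPTP Φ) {ρ σ : Matrix n n ℂ}
    (hρ : ρ.PosDef) (hΦρ : (Φ ρ).PosDef) (hσ : σ.IsHermitian) :
    chiSq f (Φ ρ) (Φ σ) ≤ chiSq f ρ σ := by
  rw [← sub_nonneg, chiSq_sub_chiSq_map hf hΦ hρ hΦρ hσ]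
  exact (Complex.le_def.1 ((Matrix.le_iff.1
    (hΦ.conj_inv_fisherMatrix_le hρ hΦρ hf)).dotProduct_mulVec_nonneg _)).1

/-- Equality in the data processing inequality forces the intertwining relation for the inverse
quantum Fisher operators. -/
theorem hsAdjoint_Jinv_map_of_chiSq_eq {f : ℝ → ℝ} (hf : IsStandardMonotone f)
    {Φ : Matrix n n ℂ →ₗ[ℂ] Matrix m m ℂ} (hΦ : IsCPTP Φ) {ρ σ : Matrix n n ℂ}
    (hρ : ρ.PosDef) (hΦρ : (Φ ρ).PosDef) (hσ : σ.IsHermitian)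
    (h : chiSq f ρ σ = chiSq f (Φ ρ) (Φ σ)) :
    hsAdjoint Φ (Jinv f (Φ ρ) (Φ σ)) = Jinv f ρ σ := by
  have hP := Matrix.le_iff.1 (hΦ.conj_inv_fisherMatrix_le hρ hΦρ hf)
  have hvec : ∀ A : Matrix n n ℂ, vectorize (hsAdjoint Φ (Jinv f (Φ ρ) (Φ A))) =
      ((superMatrix Φ)ᴴ * (fisherMatrix f (Φ ρ))⁻¹ * superMatrix Φ) *ᵥ vectorize A := by
    intro A
    rw [vectorize_hsAdjoint, vectorize_Jinv hf hΦρ, vectorize_map, Matrix.mulVec_mulVec,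
      Matrix.mulVec_mulVec, Matrix.mul_assoc]
  have hzero : star (vectorize (ρ - σ)) ⬝ᵥ ((fisherMatrix f ρ)⁻¹ - (superMatrix Φ)ᴴ *
        (fisherMatrix f (Φ ρ))⁻¹ * superMatrix Φ) *ᵥ vectorize (ρ - σ) = 0 := by
    have h1 := hP.dotProduct_mulVec_nonneg (vectorize (ρ - σ))
    have h2 := chiSq_sub_chiSq_map hf hΦ hρ hΦρ hσ
    rw [h, sub_self] at h2
    -- The divergence records only the real part; the imaginary part vanishes because the form is
    -- nonnegative in the order on ℂ.
    exact Complex.ext h2.symm (Complex.le_def.1 h1).2.symm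
  rw [hP.dotProduct_mulVec_zero_iff, Matrix.sub_mulVec, sub_eq_zero, ← vectorize_Jinv hf hρ,
    ← hvec] at hzero
  have h3 := vectorize_injective hzero
  rw [map_sub, map_sub, map_sub, map_sub, Jinv_self hf.one hρ, Jinv_self hf.one hΦρ,
    hsAdjoint_one hΦ] at h3
  exact (sub_right_injective h3).symm

theorem petz_map_self {f f' : ℝ → ℝ} (hf : IsStandardMonotone f) (hf' : IsStandardMonotone f')
    {Φ : Matrix n n ℂ →ₗ[ℂ] Matrix m m ℂ} (hΦ : IsCPTP Φ) {ρ : Matrix n n ℂ}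
    (hρ : ρ.PosDef) (hΦρ : (Φ ρ).PosDef) : petz f' f ρ Φ (Φ ρ) = ρ := by
  rw [petz, LinearMap.comp_apply, LinearMap.comp_apply, Jinv_self hf.one hΦρ, hsAdjoint_one hΦ,
    J_of_commute hf'.one hρ (by simp), Matrix.one_mul]

theorem J_Jinv_of_commute {f f' : ℝ → ℝ} (hf : f 1 = 1) (hf' : f' 1 = 1) {ρ σ : Matrix n n ℂ}
    (hρ : ρ.PosDef) (h : ρ * σ = σ * ρ) : J f' ρ (Jinv f ρ σ) = σ := by
  rw [Jinv_of_commute hf hρ h, J_of_commute hf' hρ, Matrix.mul_assoc, inv_mul_of_posDef hρ,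
    Matrix.mul_one]
  rw [← Matrix.mul_assoc, h, Matrix.mul_assoc, Matrix.mul_assoc, mul_inv_of_posDef hρ,
    inv_mul_of_posDef hρ]

/-- Inverting J_{f'} gives J_{f'}⁻¹ σ = J_f⁻¹ σ, and the common factor R_ρ⁻¹ cancels. -/
theorem cfc_inv_modular_mulVec_eq {f f' : ℝ → ℝ} (hf : IsStandardMonotone f)
    (hf' : IsStandardMonotone f') {ρ σ : Matrix n n ℂ} (hρ : ρ.PosDef)
    (h : J f' ρ (Jinv f ρ σ) = σ) :
    cfc (fun x => 1 / f' x) (modular ρ) *ᵥ vectorize σ =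
      cfc (fun x => 1 / f x) (modular ρ) *ᵥ vectorize σ := by
  have h1 : (fisherMatrix f' ρ)⁻¹ *ᵥ vectorize σ = (fisherMatrix f ρ)⁻¹ *ᵥ vectorize σ := by
    have h2 := congrArg (fun X => (fisherMatrix f' ρ)⁻¹ *ᵥ vectorize X) h
    rw [vectorize_J, vectorize_Jinv hf hρ, Matrix.mulVec_mulVec,
      inv_mul_of_posDef (posDef_fisherMatrix hf' hρ), Matrix.one_mulVec] at h2
    exact h2.symm
  rw [inv_fisherMatrix hf hρ, inv_fisherMatrix hf' hρ] at h1
  have h3 := congrArg (fun v => rightMul ρ *ᵥ v) h1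
  simpa only [Matrix.mulVec_mulVec, ← Matrix.mul_assoc, rightMul_mul, inv_mul_of_posDef hρ,
    rightMul_one, Matrix.one_mul] using h3

/-- The commuting case: the recovery map built from `ρ^{1/2} (·) ρ^{1/2}` is a channel. -/
theorem exists_recovery_channel {f : ℝ → ℝ} (hf : IsStandardMonotone f)
    {Φ : Matrix n n ℂ →ₗ[ℂ] Matrix m m ℂ} (hΦ : IsCPTP Φ) {ρ σ : Matrix n n ℂ}
    (hρ : ρ.PosDef) (hΦρ : (Φ ρ).PosDef) (hcomm : ρ * σ = σ * ρ)
    (hσ : hsAdjoint Φ (Jinv f (Φ ρ) (Φ σ)) = Jinv f ρ σ)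
    (hJ : IsCompletelyPositive (Jinv f (Φ ρ))) :
    ∃ R : Matrix m m ℂ →ₗ[ℂ] Matrix n n ℂ, IsCPTP R ∧ R (Φ ρ) = ρ ∧ R (Φ σ) = σ := by
  let S := CFC.sqrt ρ
  have hSS : S * S = ρ := CFC.sqrt_mul_sqrt_self ρ hρ.posSemidef.nonneg
  have hS : Sᴴ = S := (CFC.sqrt_nonneg ρ).posSemidef.1.eq
  have hSσ : S * σ = σ * S := by
    have : Commute ρ σ := hcomm
    exact (this.cfcₙ_nnreal NNReal.sqrt).eq
  refine ⟨(LinearMap.mulLeft ℂ S ∘ₗ LinearMap.mulRight ℂ Sᴴ) ∘ₗ hsAdjoint Φ ∘ₗ Jinv f (Φ ρ),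
    ⟨(isCompletelyPositive_conj S).comp (hΦ.1.hsAdjoint.comp hJ), fun A => ?_⟩, ?_, ?_⟩
  · simp only [LinearMap.comp_apply, LinearMap.mulLeft_apply, LinearMap.mulRight_apply, hS]
    rw [← Matrix.mul_assoc, Matrix.trace_mul_comm, ← Matrix.mul_assoc, hSS]
    have h1 := trace_hsAdjoint Φ ρ (Jinv f (Φ ρ) A)
    rw [hρ.1.eq, hΦρ.1.eq, trace_mul_Jinv hf hΦρ] at h1
    exact h1
  · simp only [LinearMap.comp_apply, LinearMap.mulLeft_apply, LinearMap.mulRight_apply, hS]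
    rw [Jinv_self hf.one hΦρ, hsAdjoint_one hΦ, Matrix.one_mul, hSS]
  · simp only [LinearMap.comp_apply, LinearMap.mulLeft_apply, LinearMap.mulRight_apply, hS]
    rw [hσ, Jinv_of_commute hf.one hρ hcomm]
    have hSinv : S * ρ⁻¹ * S = 1 := by
      have h1 : ρ⁻¹ * S = S * ρ⁻¹ := by
        have h2 : ρ * S = S * ρ := by rw [← hSS, Matrix.mul_assoc]
        calc ρ⁻¹ * S = ρ⁻¹ * (S * ρ) * ρ⁻¹ := by
              rw [Matrix.mul_assoc, Matrix.mul_assoc, mul_inv_of_posDef hρ, Matrix.mul_one]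
          _ = S * ρ⁻¹ := by
              rw [← h2, ← Matrix.mul_assoc, inv_mul_of_posDef hρ, Matrix.one_mul]
      rw [Matrix.mul_assoc, h1, ← Matrix.mul_assoc, hSS, mul_inv_of_posDef hρ]
    calc S * (σ * ρ⁻¹ * S) = S * σ * ρ⁻¹ * S := by simp only [Matrix.mul_assoc]
      _ = σ * (S * ρ⁻¹ * S) := by rw [hSσ]; simp only [Matrix.mul_assoc]
      _ = σ := by rw [hSinv, Matrix.mul_one]

end Divergence

end QuantumFisher

/-! ### The main theorem. -/

theorem mainTheorem7 {n m : Type*} [Fintype n] [DecidableEq n] [Fintype m] [DecidableEq m]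
    (Φ : Matrix n n ℂ →ₗ[ℂ] Matrix m m ℂ) (hΦ : QuantumFisher.IsCPTP Φ)
    (ρ σ : Matrix n n ℂ)
    (hρ : QuantumFisher.IsState ρ) (hρ_full : ρ.PosDef) (hΦρ_full : (Φ ρ).PosDef)
    (hσ : QuantumFisher.IsState σ)
    (f : ℝ → ℝ) (hf : QuantumFisher.IsStandardMonotone f)
    (hpres : QuantumFisher.chiSq f ρ σ = QuantumFisher.chiSq f (Φ ρ) (Φ σ)) :
    -- one fixed `f'` that differs from `f` at the ratios of distinct eigenvalues of `ρ`
    (∀ f' : ℝ → ℝ, QuantumFisher.IsStandardMonotone f' →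
      (∀ a ∈ spectrum ℝ ρ, ∀ b ∈ spectrum ℝ ρ, a ≠ b → f' (a / b) ≠ f (a / b)) →
      (QuantumFisher.RecoversBoth f' f ρ σ Φ ↔ ρ * σ = σ * ρ)) ∧
    -- all `f'` that differ from `f` as functions on `(0, ∞)`
    ((∀ f' : ℝ → ℝ, QuantumFisher.IsStandardMonotone f' → (∃ x : ℝ, 0 < x ∧ f' x ≠ f x) →
      QuantumFisher.RecoversBoth f' f ρ σ Φ) ↔ ρ * σ = σ * ρ) ∧
    -- if the states commute and `J_f⁻¹` is completely positive, every divergence is preserved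
    (ρ * σ = σ * ρ →
      QuantumFisher.IsCompletelyPositive (QuantumFisher.Jinv f (Φ ρ)) →
      ∀ g : ℝ → ℝ, QuantumFisher.IsStandardMonotone g →
        QuantumFisher.chiSq g ρ σ = QuantumFisher.chiSq g (Φ ρ) (Φ σ)) := by
  have hσh := hσ.1.1
  have hint := QuantumFisher.hsAdjoint_Jinv_map_of_chiSq_eq hf hΦ hρ_full hΦρ_full hσh hpres
  have hD := (QuantumFisher.posDef_modular hρ_full).1
  have hrec : ∀ f' : ℝ → ℝ, QuantumFisher.IsStandardMonotone f' →
      (QuantumFisher.RecoversBoth f' f ρ σ Φ ↔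
        QuantumFisher.J f' ρ (QuantumFisher.Jinv f ρ σ) = σ) := by
    intro f' hf'
    rw [QuantumFisher.RecoversBoth, ← hint]
    exact and_iff_right (QuantumFisher.petz_map_self hf hf' hΦ hρ_full hΦρ_full)
  have hback : ρ * σ = σ * ρ → ∀ f' : ℝ → ℝ, QuantumFisher.IsStandardMonotone f' →
      QuantumFisher.RecoversBoth f' f ρ σ Φ := fun hcomm f' hf' =>
    (hrec f' hf').2 (QuantumFisher.J_Jinv_of_commute hf.one hf'.one hρ_full hcomm)
  refine ⟨fun f' hf' hne => ⟨fun h => ?_, fun h => hback h f' hf'⟩,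
    ⟨fun h => ?_, fun h f' hf' _ => hback h f' hf'⟩, fun hcomm hJ g hg => ?_⟩
  · rw [← QuantumFisher.modular_mulVec_eq_self_iff hρ_full]
    refine QuantumFisher.mulVec_eq_self_of_cfc_mulVec_eq hD ?_
      (QuantumFisher.cfc_inv_modular_mulVec_eq hf hf' hρ_full ((hrec f' hf').1 h))
    intro x hx hx1 heq
    obtain ⟨a, ha, b, hb, rfl⟩ := QuantumFisher.exists_div_eq_of_mem_spectrum_modular hρ_full hx
    refine hne a ha b hb ?_ (by simpa using heq)
    rintro rfl
    exact hx1 (div_self (QuantumFisher.pos_of_mem_spectrum hρ_full ha).ne')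
  · have key : ∀ f' : ℝ → ℝ, QuantumFisher.IsStandardMonotone f' →
        (cfc (fun x => 1 / f' x) (QuantumFisher.modular ρ)).mulVec (QuantumFisher.vectorize σ) =
        (cfc (fun x => 1 / f x) (QuantumFisher.modular ρ)).mulVec
          (QuantumFisher.vectorize σ) := by
      intro f' hf'
      -- The hypothesis omits functions equal to `f` on (0, ∞), but for those the identity is
      -- trivial; so `f` may coincide with one of the two test functions.
      by_cases hne : ∃ x : ℝ, 0 < x ∧ f' x ≠ f x
      · exact QuantumFisher.cfc_inv_modular_mulVec_eq hf hf' hρ_full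
          ((hrec f' hf').1 (h f' hf' hne))
      · push Not at hne
        congr 1
        refine cfc_congr fun x hx => ?_
        simp only [hne x (QuantumFisher.pos_of_mem_spectrum (QuantumFisher.posDef_modular hρ_full) hx)]
    rw [← QuantumFisher.modular_mulVec_eq_self_iff hρ_full]
    refine QuantumFisher.mulVec_eq_self_of_cfc_mulVec_eq hD ?_
      ((key _ QuantumFisher.isStandardMonotone_arithmetic).trans
        (key _ QuantumFisher.isStandardMonotone_harmonic).symm)
    intro x hx hx1 heq
    have hx0 : 0 < x :=
      QuantumFisher.pos_of_mem_spectrum (QuantumFisher.posDef_modular hρ_full) hx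
    field_simp at heq
    -- (1 + x)/2 = 2x/(1 + x) means (1 + x)² = 4x.
    have h0 : (x - 1) * (x - 1) = 0 := by linarith
    exact hx1 (sub_eq_zero.1 (mul_self_eq_zero.1 h0))
  · obtain ⟨R, hR, hRρ, hRσ⟩ :=
      QuantumFisher.exists_recovery_channel hf hΦ hρ_full hΦρ_full hcomm hint hJ
    refine le_antisymm ?_ (QuantumFisher.chiSq_map_le hg hΦ hρ_full hΦρ_full hσh)
    have hΦσ : (Φ σ).IsHermitian := by
      rw [Matrix.IsHermitian, ← hΦ.1.map_conjTranspose, hσh.eq]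
    -- Data processing along the recovery channel gives the reverse inequality.
    simpa only [hRρ, hRσ] using
      QuantumFisher.chiSq_map_le hg hR hΦρ_full (by rwa [hRρ]) hΦσ
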